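/- Let $\mathbb X$ be a Polish space with its Borel $\sigma$-algebra, and let $\Phi=\sum_{j\le N}\delta_{X_j}$ be a finite simple point process on $\mathbb X$ with law $\mathbf P_\Phi$. Let $H(ds)=h(s)\,ds$ be a probability measure on $(0,\infty)$ that has a density $h$. Given $\Phi$, attach to its points i.i.d. marks $S_j\sim H$ and put $\tilde\mu=\sum_{j\le N} S_j\delta_{X_j}$ and $\tilde p=\tilde\mu/\tilde\mu(\mathbb X)$; that is, $\tilde p\sim \mathrm{nRM}(\mathbf P_\Phi,H)$. Let $n\ge 1$. Given $\tilde\mu$, the observations $\mathbf Y=(Y_1,\dots,Y_n)$ are i.i.d. from $\tilde p$ and, independently, $U_n\sim\mathrm{Gamma}(n,\tilde\mu(\mathbb X))$ (shape, rate). If $\tilde\mu(\mathbb X)=0$ nothing is observed, so the joint law of $(\mathbf Y,U_n,\tilde\mu)$ has total mass $\mathsf P(\tilde\mu(\mathbb X)>0)$. For $k\ge1$ let $M_{\Phi^k}(B)=\mathsf E[\Phi^k(B)]$ be the $k$-th moment measure, and assume that $M_{\Phi^k}$ is $\sigma$-finite for $1\le k\le n$. The $k$-th Palm distributions $\mathbf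 P^{\mathbf x}_\Phi$ are defined, as a probability kernel, by $\mathsf E[\mathbf 1_L(\Phi)\,\Phi^k(B)]=\int_B \mathbf P^{\mathbf x}_\Phi(L)\,M_{\Phi^k}(d\mathbf x)$ for all measurable $L$ and all measurable sets $B$ of $k$-tuples of pairwise distinct points. If $\Phi_{\mathbf x}\sim\mathbf P_\Phi^{\mathbf x}$, let $\Phi^!_{\mathbf x}=\Phi_{\mathbf x}-\sum_{j}\delta_{x_j}$, and let $\tilde\mu^!_{\mathbf x}$ be obtained from $\Phi^!_{\mathbf x}$ by attaching i.i.d. marks from $H$, in the same way as $\tilde\mu$ is obtained from $\Phi$. Such reduced Palm kernels for $1\le k\le n$, and regular conditional distributions of $\tilde\mu$ given $(\mathbf Y,U_n)$ and of $U_n$ given $\mathbf Y$, exist. For every version of them the following holds. Write $\kappa(u,m)=\int e^{-us}s^m\,H(ds)$, let $y_1^*,\dots,y_k^*$ be the distinct values in $\mathbf y$ (in any order), and let $n_j$ be the number of $i$ with $y_i=y_j^*$. 1. For almost every $(\mathbf y,u)$ with respect to the law of $(\mathbf Y,U_n)$, the conditional law of $\tilde\mu$ given $\mathbf Y=\mathbf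 y$ and $U_n=u$ is the law of $\sum_{j=1}^k S_j^*\delta_{y_j^*}+\tilde\mu'$, where $S_1^*,\dots,S_k^*,\tilde\mu'$ are independent, $S_j^*$ has density on $(0,\infty)$ proportional to $e^{-us}s^{n_j}h(s)$, and $\tilde\mu'$ is a random measure with Laplace functional $$\mathsf E\Big[e^{-\int f\,d\tilde\mu'}\Big]=\frac{\mathsf E\big[\exp\{-\int (f(z)+u)\,\tilde\mu^!_{\mathbf y^*}(dz)\}\big]}{\mathsf E\big[\exp\{-u\,\tilde\mu^!_{\mathbf y^*}(\mathbb X)\}\big]}\qquad\text{for all measurable } f:\mathbb X\to[0,\infty).$$ 2. For almost every $\mathbf y$ with respect to the law of $\mathbf Y$, the conditional law of $U_n$ given $\mathbf Y=\mathbf y$ has a density on $(0,\infty)$ with respect to Lebesgue measure, proportional to $$u^{n-1}\,\mathsf E\big[e^{-u\,\tilde\mu^!_{\mathbf y^*}(\mathbb X)}\big]\prod_{j=1}^k\kappa(u,n_j).$$ -/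

import Mathlib

open MeasureTheory ProbabilityTheory
open scoped ENNReal NNReal

noncomputable section

namespace NRM

/-- A finite configuration of points `(x_1, …, x_m)` of `X`, of arbitrary length `m`. A finite point
process is a random element of this type, the order of the points being irrelevant. -/
abbrev Config (X : Type*) := Σ m : ℕ, (Fin m → X)

/-- The counting measure `∑ j, δ_{x_j}` of a configuration. -/
def Config.counting {X : Type*} [MeasurableSpace X] (c : Config X) : Measure X :=
  ∑ j, Measure.dirac (c.2 j)

/-- The purely atomic measure `∑ j, s_j δ_{x_j}` with points `x_j` and nonnegative jumps `s_j`. -/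
def atomic {X : Type*} [MeasurableSpace X] {m : ℕ} (x : Fin m → X) (s : Fin m → ℝ) : Measure X :=
  ∑ j, ENNReal.ofReal (s j) • Measure.dirac (x j)

/-- `μ / μ(α)`; this is the zero measure when `μ(α) = 0`. -/
def normalized {α : Type*} [MeasurableSpace α] (μ : Measure α) : Measure α :=
  (μ Set.univ)⁻¹ • μ

/-- The law `RM(P_Φ, H)` of `∑ j, S_j δ_{X_j}`, where `P` is the law of the points `(X_j)` of the
finite point process `Φ` and, given `Φ`, the marks `S_j` are i.i.d. with law `H`. -/
def rmLaw {X : Type*} [MeasurableSpace X] (P : Measure (Config X)) (H : Measure ℝ) :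
    Measure (Measure X) :=
  P.bind fun c => (Measure.pi fun _ : Fin c.1 => H).map (atomic c.2)

/-- The joint law of `((Y, U_n), μ̃)`: `μ̃ ∼ RM(P_Φ, H)`; given `μ̃`, the observations
`Y_1, …, Y_n` are i.i.d. from `μ̃ / μ̃(X)` and, independently, `U_n ∼ Gamma(n, μ̃(X))` (shape and
rate). If `μ̃(X) = 0` nothing is observed, so for `n ≥ 1` the total mass is the probability
of `μ̃(X) > 0`. -/
def jointLaw {X : Type*} [MeasurableSpace X] (P : Measure (Config X)) (H : Measure ℝ) (n : ℕ) :
    Measure (((Fin n → X) × ℝ) × Measure X) :=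
  (rmLaw P H).bind fun μ =>
    ((Measure.pi fun _ : Fin n => normalized μ).prod
      (gammaMeasure n (μ Set.univ).toReal)).prod (Measure.dirac μ)

/-- The `k`-th moment measure `M_{Φ^k}(B) = E[Φ^k(B)]` of the point process `Φ`. -/
def momentMeasure {X : Type*} [MeasurableSpace X] (P : Measure (Config X)) (k : ℕ) :
    Measure (Fin k → X) :=
  P.bind fun c => Measure.pi fun _ : Fin k => c.counting

/-- The `k`-th Campbell measure `E[1_L(Φ) Φ^k(B)]` of the measurable rectangle `B × L`. -/
def campbell {X : Type*} [MeasurableSpace X] (P : Measure (Config X)) (k : ℕ)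
    (B : Set (Fin k → X)) (L : Set (Measure X)) : ℝ≥0∞ :=
  ∫⁻ c, L.indicator 1 c.counting * (Measure.pi fun _ : Fin k => c.counting) B ∂P

/-- `Q` is (a version of) the `k`-th reduced Palm kernel of the point process `Φ`, at tuples of
pairwise distinct points: `Q x` is the law of the points of `Φ^!_x`, where
`Φ_x = Φ^!_x + ∑ j, δ_{x_j}` has the Palm distribution of `Φ` at `x`, that is, the laws of the
`Φ_x` disintegrate the `k`-th Campbell measure with respect to the `k`-th moment measure. -/
structure IsReducedPalmKernel {X : Type*} [MeasurableSpace X] (P : Measure (Config X)) (k : ℕ)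
    (Q : Kernel (Fin k → X) (Config X)) : Prop where
  isMarkovKernel : IsMarkovKernel Q
  campbell_eq : ∀ B : Set (Fin k → X), MeasurableSet B → (∀ x ∈ B, Function.Injective x) →
    ∀ L : Set (Measure X), MeasurableSet L →
      campbell P k B L =
        ∫⁻ x in B, Q x {c | c.counting + ∑ j, Measure.dirac (x j) ∈ L} ∂(momentMeasure P k)

/-- The Laplace functional `E[exp(-∫ f dμ)]` of a random measure `μ` with law `ρ`
(with `exp(-∞) = 0`). -/
def laplace {X : Type*} [MeasurableSpace X] (ρ : Measure (Measure X)) (f : X → ℝ≥0) : ℝ≥0∞ :=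
  ∫⁻ μ, EReal.exp (-((∫⁻ z, (f z : ℝ≥0∞) ∂μ : ℝ≥0∞) : EReal)) ∂ρ

/-- `κ(u, m) = ∫ e^{-us} s^m H(ds)`. -/
def kappa (H : Measure ℝ) (u : ℝ) (m : ℕ) : ℝ≥0∞ :=
  ∫⁻ s, ENNReal.ofReal (Real.exp (-u * s) * s ^ m) ∂H

/-- The probability law on `(0, ∞)` with density proportional to `g`. -/
def lawWithDensityPropTo (g : ℝ → ℝ≥0∞) : Measure ℝ :=
  normalized ((volume.restrict (Set.Ioi 0)).withDensity g)

/-- The vector `y` has the distinct values `y*_1, …, y*_k`, and `y_i = y*_{τ i}`. -/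
structure IsDistinctValues {X : Type*} {n k : ℕ} (y : Fin n → X) (ystar : Fin k → X)
    (τ : Fin n → Fin k) : Prop where
  injective : Function.Injective ystar
  surjective : Function.Surjective τ
  eq_comp : ∀ i, y i = ystar (τ i)

/-- The number `n_j` of the `i` with `y_i = y*_j`. -/
def count {n k : ℕ} (τ : Fin n → Fin k) (j : Fin k) : ℕ :=
  (Finset.univ.filter fun i => τ i = j).card

end NRM

end

/-! Fix a pattern of ties, that is, a surjection τ from the `n` observations onto `k` labels. Given
distinct points x with positive marks s and total mass T = ∑ s_j, the observed indices i have
probability ∏ s_{i l} / T^n, while the gamma density is T^n u^{n-1} e^{-uT} / Γ(n). The powers of T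
cancel, and e^{-uT} is a product over the points. The observations have pattern τ exactly when i = a
∘ τ for an embedding a. The weight is then u^{n-1} / Γ(n) times ∏_j e^{-u s_{a j}} s_{a j}^{n_j}
times e^{-u μ'(X)}, where μ' is the part of the measure carried by the points outside a. Summing
over a and averaging over Φ is integration against the reduced Campbell measure, which disintegrates
into the moment measure on distinct tuples and the reduced Palm kernel. Since the marks are
independent, this yields `lintegral_jointLaw`.

For fixed y* and u the weight factorizes into tilted jumps and the law of the reduced Palm random
measure tilted by e^{-u μ(X)}. Normalizing gives the first claim (`jointLaw_prod_eq`,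
`posteriorLaw_apply`, `laplace_tilt`). Integrating out jumps and remainder leaves the density in u
of the second claim (`palmMass_one`, `auxMass_eq`).

Two measure-theoretic points remain. No standard Borel structure on `Measure X` is used: finite
measures are coded by real numbers (`exists_determining_map`), so that equality of laws reduces to
countably many identities, and conditional laws are built on marked configurations. Moreover a Palm
kernel takes values in enumerated configurations, but its defining equation sees only counting
measures. Lusin separation (`map_eq_of_fibre_const`) shows that this information determines the law
of the marked measure, so every version of the kernel can be used. -/

noncomputable section

namespace NRM

/-! ### Countable disjoint unions of standard Borel spaces -/

section Sigma

variable {ι : Type*} {β : ι → Type*} [∀ i, MeasurableSpace (β i)] {γ : Type*} [MeasurableSpace γ]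

lemma measurable_sigma_mk (i : ι) : Measurable (Sigma.mk i : β i → Sigma β) :=
  fun _ hs => MeasurableSpace.measurableSet_iInf.1 hs i

lemma measurable_of_sigma {f : Sigma β → γ} (hf : ∀ i, Measurable fun b => f ⟨i, b⟩) :
    Measurable f :=
  fun _ hs => MeasurableSpace.measurableSet_iInf.2 fun i => hf i hs

/-- Both σ-algebras are tested summand by summand, because each inclusion is an open embedding.
Configuration spaces thereby become standard Borel, as disintegration and Lusin separation require.
-/
instance standardBorelSpace_sigma [Countable ι] [∀ i, StandardBorelSpace (β i)] :
    StandardBorelSpace (Sigma β) := by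
  let := fun i => upgradeStandardBorel (β i)
  refine ⟨inferInstance, ⟨le_antisymm (fun s hs => ?_) ?_⟩, inferInstance⟩
  · have h : s = ⋃ i, Sigma.mk i '' (Sigma.mk i ⁻¹' s) := by
      ext ⟨i, b⟩
      simp only [Set.mem_iUnion, Set.mem_image, Set.mem_preimage]
      exact ⟨fun h => ⟨i, b, h, rfl⟩, fun ⟨_, _, h, e⟩ => e ▸ h⟩
    rw [h]
    let : MeasurableSpace (Sigma β) := borel (Sigma β)
    have : BorelSpace (Sigma β) := ⟨rfl⟩
    refine MeasurableSet.iUnion fun i => ?_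
    exact Topology.IsOpenEmbedding.sigmaMk.measurableEmbedding.measurableSet_image.2
      (measurable_sigma_mk i hs)
  · refine MeasurableSpace.generateFrom_le fun s hs => ?_
    refine MeasurableSpace.measurableSet_iInf.2 fun i => ?_
    exact (hs.preimage continuous_sigmaMk).measurableSet

end Sigma

/-! ### Powers of a measure -/

section PiMeasure

variable {α : Type*} [MeasurableSpace α]

lemma measurable_measure_pi {β ι : Type*} [Fintype ι] [MeasurableSpace β] {ν : β → Measure α}
    [∀ b, IsFiniteMeasure (ν b)] (hν : Measurable ν) :
    Measurable fun b => Measure.pi fun _ : ι => ν b := by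
  refine Measurable.measure_of_isPiSystem generateFrom_pi.symm isPiSystem_pi ?_ ?_
  · rintro _ ⟨s, hs, rfl⟩
    simp only [Measure.pi_pi]
    exact Finset.measurable_prod _ fun i _ =>
      Measure.measurable_measure.1 hν _ (hs i (Set.mem_univ i))
  · simp only [Measure.pi_univ]
    exact Finset.measurable_prod _ fun i _ => Measure.measurable_measure.1 hν _ MeasurableSet.univ

/-- A power of a finitely supported measure is a sum over maps of indices. -/
lemma pi_sum_smul_dirac {ι κ : Type*} [Fintype ι] [Fintype κ] [DecidableEq ι] (x : κ → α)
    (w : κ → ℝ≥0∞) (hw : ∀ j, w j ≠ ∞) :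
    Measure.pi (fun _ : ι => ∑ j, w j • Measure.dirac (x j)) =
      ∑ i : ι → κ, (∏ l, w (i l)) • Measure.dirac (x ∘ i) := by
  classical
  have : IsFiniteMeasure (∑ j, w j • Measure.dirac (x j)) := by
    refine ⟨?_⟩
    simp only [Measure.coe_finsetSum, Finset.sum_apply, Measure.smul_apply, smul_eq_mul,
      measure_univ, mul_one]
    exact ENNReal.sum_lt_top.2 fun j _ => (hw j).lt_top
  refine Measure.pi_eq fun s hs => ?_
  simp only [Measure.coe_finsetSum, Finset.sum_apply, Measure.smul_apply, smul_eq_mul]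
  rw [Finset.prod_univ_sum, Fintype.piFinset_univ]
  refine Finset.sum_congr rfl fun i _ => ?_
  rw [Finset.prod_mul_distrib, Measure.dirac_apply' _ (MeasurableSet.univ_pi hs)]
  congr 1
  simp_rw [Measure.dirac_apply' _ (hs _)]
  simp only [Set.indicator_apply, Set.mem_univ_pi, Function.comp_apply, Pi.one_apply]
  by_cases h : ∀ l, x (i l) ∈ s l
  · simp [h]
  · rw [if_neg h]
    push Not at h
    obtain ⟨l, hl⟩ := h
    exact (Finset.prod_eq_zero (Finset.mem_univ l) (by simp [hl])).symm

/-- The integral of a product of functions of the coordinates with respect to a power. -/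
lemma lintegral_pi_prod {ι : Type*} [Fintype ι] (μ : Measure α) [IsProbabilityMeasure μ]
    {f : ι → α → ℝ≥0∞} (hf : ∀ i, Measurable (f i)) :
    ∫⁻ s, ∏ i, f i (s i) ∂(Measure.pi fun _ : ι => μ) = ∏ i, ∫⁻ t, f i t ∂μ := by
  have h := iIndepFun.comp (iIndepFun_pi (μ := fun _ : ι => μ) (X := fun _ => id)
    fun i => aemeasurable_id) f hf
  have := lintegral_prod_eq_prod_lintegral_of_indepFun Finset.univ
    (fun i (s : ι → α) => f i (s i)) h fun i => (hf i).comp (measurable_pi_apply i)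
  rw [this]
  refine Finset.prod_congr rfl fun i _ => ?_
  exact (measurePreserving_eval (fun _ : ι => μ) i).lintegral_comp (hf i)

/-- Splitting the coordinates of a power into two blocks. -/
lemma lintegral_pi_split {ι κ l : Type*} [Fintype ι] [Fintype κ] [Fintype l] (μ : Measure α)
    [IsProbabilityMeasure μ] (e : κ ⊕ l ≃ ι) {f : (ι → α) → ℝ≥0∞} (hf : Measurable f) :
    ∫⁻ s, f s ∂(Measure.pi fun _ : ι => μ) =
      ∫⁻ s, ∫⁻ t, f (Sum.elim s t ∘ e.symm) ∂(Measure.pi fun _ : l => μ)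
        ∂(Measure.pi fun _ : κ => μ) := by
  have h1 := measurePreserving_piCongrLeft (fun _ : ι => μ) e
  have h2 := measurePreserving_sumPiEquivProdPi_symm (fun _ : κ ⊕ l => μ)
  have hm : Measurable fun p : (κ → α) × (l → α) => f (Sum.elim p.1 p.2 ∘ e.symm) := by
    refine hf.comp (measurable_pi_lambda _ fun i => ?_)
    rcases h : e.symm i with a | b <;> simp only [Function.comp_apply, h, Sum.elim_inl,
      Sum.elim_inr] <;> fun_prop
  rw [lintegral_lintegral (f := fun s t => f (Sum.elim s t ∘ e.symm)) hm.aemeasurable]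
  rw [← h1.lintegral_comp hf]
  have h3 := h2.lintegral_comp (hf.comp h1.measurable)
  simp only [Function.comp_def] at h3
  rw [← h3]
  refine lintegral_congr fun p => congrArg f ?_
  ext i
  obtain ⟨a, rfl⟩ := e.surjective i
  simp only [Function.comp_apply, Equiv.symm_apply_apply]
  rw [MeasurableEquiv.piCongrLeft_apply_apply (β := fun _ => α)]
  cases a <;> rfl

end PiMeasure

/-! ### Coding finite measures by real numbers -/

section Code

variable {X : Type*} [MeasurableSpace X]

/-- A finite measure is determined by its total mass and its values on a countable generating
π-system, here the pullback of the rational half-lines. This countable vector of values embeds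
measurably into the real line. -/
lemma exists_determining_map [StandardBorelSpace X] :
    ∃ φ : Measure X → ℝ, Measurable φ ∧ ∀ L : Set (Measure X), MeasurableSet L →
      ∃ B : Set ℝ, MeasurableSet B ∧ ∀ μ : Measure X, IsFiniteMeasure μ → (μ ∈ L ↔ φ μ ∈ B) := by
  obtain ⟨e, he⟩ := exists_measurableEmbedding_real X
  obtain ⟨e', he'⟩ := exists_measurableEmbedding_real (Option ℚ → ℝ≥0∞)
  let g : Measure X → Option ℚ → ℝ≥0∞ := fun μ o =>
    o.elim (μ Set.univ) fun q => μ (e ⁻¹' Set.Iio (q : ℝ))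
  have hg : Measurable g := by
    refine measurable_pi_lambda _ fun o => ?_
    cases o with
    | none => exact Measure.measurable_coe MeasurableSet.univ
    | some q => exact Measure.measurable_coe (he.measurable measurableSet_Iio)
  refine ⟨e' ∘ g, he'.measurable.comp hg, fun L hL => ?_⟩
  -- With the σ-algebra pulled back by `g`, measurability of the inclusion says precisely that each
  -- measurable `L`, restricted to finite measures, is a preimage under `g`.
  let T := {μ : Measure X // IsFiniteMeasure μ}
  let mT : MeasurableSpace T := MeasurableSpace.comap (fun μ : T => g μ.1) inferInstance
  have hgT : Measurable fun μ : T => g μ.1 := comap_measurable _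
  have : ∀ μ : T, IsFiniteMeasure μ.1 := fun μ => μ.2
  have hval : Measurable fun μ : T => μ.1 := by
    refine Measurable.measure_of_isPiSystem
      (S := {s | ∃ t ∈ ⋃ a : ℚ, {Set.Iio (a : ℝ)}, e ⁻¹' t = s}) ?_
      (Real.isPiSystem_Iio_rat.comap e) ?_ ?_
    · rw [← he.comap_eq, BorelSpace.measurable_eq (α := ℝ), Real.borel_eq_generateFrom_Iio_rat,
        MeasurableSpace.comap_generateFrom]
      rfl
    · rintro _ ⟨t, ht, rfl⟩
      simp only [Set.mem_iUnion, Set.mem_singleton_iff] at ht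
      obtain ⟨q, rfl⟩ := ht
      exact (measurable_pi_apply (some q)).comp hgT
    · exact (measurable_pi_apply none).comp hgT
  obtain ⟨B, hB, hBL⟩ := hval hL
  refine ⟨e' '' B, he'.measurableSet_image.2 hB, fun μ hμ => ?_⟩
  rw [Function.comp_apply, he'.injective.mem_set_image]
  exact (Set.ext_iff.1 hBL ⟨μ, hμ⟩).symm

variable (X) in
/-- A measurable real code of measures that determines finite measures. -/
def code [StandardBorelSpace X] : Measure X → ℝ := (exists_determining_map (X := X)).choose

variable [StandardBorelSpace X]

lemma measurable_code : Measurable (code X) := exists_determining_map.choose_spec.1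

lemma exists_code_preimage {L : Set (Measure X)} (hL : MeasurableSet L) :
    ∃ B : Set ℝ, MeasurableSet B ∧
      ∀ μ : Measure X, IsFiniteMeasure μ → (μ ∈ L ↔ code X μ ∈ B) :=
  exists_determining_map.choose_spec.2 L hL

lemma eq_of_code_eq {μ ν : Measure X} (hμ : IsFiniteMeasure μ) (hν : IsFiniteMeasure ν)
    (h : code X μ = code X ν) : μ = ν := by
  ext A hA
  obtain ⟨B, -, hBL⟩ := exists_code_preimage
    (Measure.measurable_coe hA (measurableSet_singleton (μ A)))
  have h1 := (hBL μ hμ).1 rfl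
  rw [h] at h1
  exact ((hBL ν hν).2 h1).symm

/-- The rational left half-lines determine a probability measure on `ℝ`. -/
lemma ext_real_of_Iio_rat {μ ν : Measure ℝ} [IsProbabilityMeasure μ] [IsProbabilityMeasure ν]
    (h : ∀ q : ℚ, μ (Set.Iio (q : ℝ)) = ν (Set.Iio (q : ℝ))) : μ = ν := by
  refine ext_of_generate_finite _ (BorelSpace.measurable_eq (α := ℝ) ▸
    Real.borel_eq_generateFrom_Iio_rat) Real.isPiSystem_Iio_rat ?_ (by simp)
  simp only [Set.mem_iUnion, Set.mem_singleton_iff]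
  rintro _ ⟨q, rfl⟩
  exact h q

/-- Laws of random finite measures agree if the laws of the codes do. -/
lemma ext_of_code {ρ ρ' : Measure (Measure X)} [IsProbabilityMeasure ρ] [IsProbabilityMeasure ρ']
    (hρ : ∀ᵐ μ ∂ρ, IsFiniteMeasure μ) (hρ' : ∀ᵐ μ ∂ρ', IsFiniteMeasure μ)
    (h : ∀ q : ℚ, ρ (code X ⁻¹' Set.Iio (q : ℝ)) = ρ' (code X ⁻¹' Set.Iio (q : ℝ))) : ρ = ρ' := by
  have hmap : ρ.map (code X) = ρ'.map (code X) := by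
    have := Measure.isProbabilityMeasure_map (μ := ρ) (measurable_code (X := X)).aemeasurable
    have := Measure.isProbabilityMeasure_map (μ := ρ') (measurable_code (X := X)).aemeasurable
    refine ext_real_of_Iio_rat fun q => ?_
    rw [Measure.map_apply measurable_code measurableSet_Iio,
      Measure.map_apply measurable_code measurableSet_Iio, h q]
  ext L hL
  obtain ⟨B, hB, hBL⟩ := exists_code_preimage hL
  have h1 : ρ L = ρ (code X ⁻¹' B) := measure_congr (hρ.mono fun μ hμ => propext (hBL μ hμ))
  have h2 : ρ' L = ρ' (code X ⁻¹' B) := measure_congr (hρ'.mono fun μ hμ => propext (hBL μ hμ))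
  rw [h1, h2, ← Measure.map_apply measurable_code hB, hmap, Measure.map_apply measurable_code hB]

/-- If two measures have the same image under `f`, they have the same image under every measurable
map that is constant on the fibres of `f`. -/
lemma map_eq_of_fibre_const {C Z : Type*} [MeasurableSpace C] [StandardBorelSpace C]
    [MeasurableSpace Z] {f : C → Measure X} (hf : Measurable f) (hfin : ∀ c, IsFiniteMeasure (f c))
    {g : C → Z} (hg : Measurable g) (hfg : ∀ c c', f c = f c' → g c = g c')
    {Q Q' : Measure C} (h : Q.map f = Q'.map f) : Q.map g = Q'.map g := by
  ext S hS
  rw [Measure.map_apply hg hS, Measure.map_apply hg hS]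
  have hcf : Measurable (code X ∘ f) := measurable_code.comp hf
  -- Fibre constancy makes the coded images of `g ⁻¹' S` and of its complement disjoint. Both are
  -- analytic, since `C` is standard Borel, and Lusin separation then provides a Borel set between
  -- them.
  have hdisj : Disjoint (code X ∘ f '' (g ⁻¹' S)) (code X ∘ f '' (g ⁻¹' S)ᶜ) := by
    rw [Set.disjoint_left]
    rintro _ ⟨c, hc, rfl⟩ ⟨c', hc', hcc⟩
    have := hfg _ _ (eq_of_code_eq (hfin c') (hfin c) hcc)
    rw [Set.mem_compl_iff, Set.mem_preimage, this] at hc'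
    exact hc' hc
  obtain ⟨B, h1, h2, hB⟩ := AnalyticSet.measurablySeparable ((hg hS).analyticSet_image hcf)
    ((hg hS).compl.analyticSet_image hcf) hdisj
  have hE : g ⁻¹' S = f ⁻¹' (code X ⁻¹' B) := by
    refine Set.Subset.antisymm (fun c hc => h1 ⟨c, hc, rfl⟩) fun c hc => ?_
    by_contra hn
    exact Set.disjoint_left.1 h2 ⟨c, hn, rfl⟩ hc
  rw [hE, ← Measure.map_apply hf (measurable_code hB), h,
    Measure.map_apply hf (measurable_code hB)]

end Code

/-! ### Random measures with i.i.d. marks -/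

section RandomMeasure

variable {X : Type*} [MeasurableSpace X]

lemma measurable_atomic {m : ℕ} :
    Measurable fun p : (Fin m → X) × (Fin m → ℝ) => atomic p.1 p.2 := by
  refine Measure.measurable_of_measurable_coe _ fun A hA => ?_
  simp only [atomic, Measure.coe_finsetSum, Finset.sum_apply, Measure.smul_apply, smul_eq_mul,
    Measure.dirac_apply' _ hA]
  refine Finset.measurable_sum _ fun j _ => ?_
  exact (ENNReal.measurable_ofReal.comp (by fun_prop)).mul
    ((measurable_one.indicator hA).comp (by fun_prop))

@[fun_prop]
lemma Measurable.atomic {β : Type*} [MeasurableSpace β] {m : ℕ} {x : β → Fin m → X}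
    {s : β → Fin m → ℝ} (hx : Measurable x) (hs : Measurable s) :
    Measurable fun b => atomic (x b) (s b) :=
  measurable_atomic.comp (hx.prodMk hs)

lemma measurable_sum_dirac {m : ℕ} :
    Measurable fun x : Fin m → X => ∑ j, Measure.dirac (x j) := by
  refine Measure.measurable_of_measurable_coe _ fun A hA => ?_
  simp only [Measure.coe_finsetSum, Finset.sum_apply, Measure.dirac_apply' _ hA]
  exact Finset.measurable_sum _ fun j _ => (measurable_one.indicator hA).comp (by fun_prop)

lemma measurable_counting : Measurable (Config.counting : Config X → Measure X) :=
  measurable_of_sigma fun _ => measurable_sum_dirac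

lemma measurable_measure_add {β : Type*} [MeasurableSpace β] {μ ν : β → Measure X}
    (hμ : Measurable μ) (hν : Measurable ν) : Measurable fun b => μ b + ν b := by
  refine Measure.measurable_of_measurable_coe _ fun A hA => ?_
  simp only [Measure.coe_add, Pi.add_apply]
  exact ((Measure.measurable_coe hA).comp hμ).add ((Measure.measurable_coe hA).comp hν)

instance isFiniteMeasure_atomic {m : ℕ} (x : Fin m → X) (s : Fin m → ℝ) :
    IsFiniteMeasure (atomic x s) := by
  refine ⟨?_⟩
  simp only [atomic, Measure.coe_finsetSum, Finset.sum_apply, Measure.smul_apply, smul_eq_mul,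
    measure_univ, mul_one]
  exact ENNReal.sum_lt_top.2 fun j _ => ENNReal.ofReal_lt_top

instance isFiniteMeasure_counting (c : Config X) : IsFiniteMeasure c.counting := by
  unfold Config.counting
  infer_instance

lemma measurableSet_isFiniteMeasure : MeasurableSet {μ : Measure X | IsFiniteMeasure μ} := by
  have : {μ : Measure X | IsFiniteMeasure μ} = (fun μ => μ Set.univ) ⁻¹' Set.Iio ∞ := by
    ext μ
    exact isFiniteMeasure_iff μ
  rw [this]
  exact Measure.measurable_coe MeasurableSet.univ measurableSet_Iio

/-- The law of `∑ j, S_j δ_{x_j}` with i.i.d. marks `S_j ∼ H`, as a kernel in the points. -/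
def rmKernel (X : Type*) [MeasurableSpace X] (H : Measure ℝ) [IsProbabilityMeasure H] :
    Kernel (Config X) (Measure X) where
  toFun c := (Measure.pi fun _ : Fin c.1 => H).map (atomic c.2)
  measurable' := by
    refine measurable_of_sigma fun m => Measure.measurable_of_measurable_coe _ fun S hS => ?_
    have h : ∀ x : Fin m → X, ((Measure.pi fun _ : Fin m => H).map (atomic x)) S =
        (Measure.pi fun _ : Fin m => H) (Prod.mk x ⁻¹'
          ((fun p : (Fin m → X) × (Fin m → ℝ) => atomic p.1 p.2) ⁻¹' S)) := fun x => by
      rw [Measure.map_apply (by fun_prop) hS]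
      rfl
    simp only [h]
    exact measurable_measure_prodMk_left (measurable_atomic hS)

variable {H : Measure ℝ} [IsProbabilityMeasure H]

lemma rmKernel_apply (c : Config X) :
    rmKernel X H c = (Measure.pi fun _ : Fin c.1 => H).map (atomic c.2) := rfl

instance : IsMarkovKernel (rmKernel X H) :=
  ⟨fun c => Measure.isProbabilityMeasure_map (by fun_prop)⟩

lemma rmLaw_eq_bind (P : Measure (Config X)) : rmLaw P H = P.bind (rmKernel X H) := rfl

instance (P : Measure (Config X)) [IsProbabilityMeasure P] : IsProbabilityMeasure (rmLaw P H) := by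
  rw [rmLaw_eq_bind]
  infer_instance

lemma lintegral_rmKernel (c : Config X) {f : Measure X → ℝ≥0∞} (hf : Measurable f) :
    ∫⁻ μ, f μ ∂(rmKernel X H c) =
      ∫⁻ s, f (atomic c.2 s) ∂(Measure.pi fun _ : Fin c.1 => H) := by
  rw [rmKernel_apply, lintegral_map hf (by fun_prop)]

lemma lintegral_rmLaw (P : Measure (Config X)) {f : Measure X → ℝ≥0∞} (hf : Measurable f) :
    ∫⁻ μ, f μ ∂(rmLaw P H) = ∫⁻ c, ∫⁻ μ, f μ ∂(rmKernel X H c) ∂P := by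
  rw [rmLaw_eq_bind, Measure.lintegral_bind (rmKernel X H).aemeasurable hf.aemeasurable]

lemma ae_rmLaw_isFiniteMeasure (P : Measure (Config X)) :
    ∀ᵐ μ ∂(rmLaw P H), IsFiniteMeasure μ := by
  change rmLaw P H {μ | IsFiniteMeasure μ}ᶜ = 0
  rw [rmLaw_eq_bind, Measure.bind_apply measurableSet_isFiniteMeasure.compl
    (rmKernel X H).aemeasurable]
  simp only [rmKernel_apply]
  refine (lintegral_congr fun c => ?_).trans lintegral_zero
  rw [Measure.map_apply (by fun_prop) measurableSet_isFiniteMeasure.compl]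
  convert measure_empty (μ := Measure.pi fun _ : Fin c.1 => H)
  ext s
  simp [isFiniteMeasure_atomic]

lemma atomic_comp_equiv {m m' : ℕ} (e : Fin m ≃ Fin m') (x : Fin m' → X) (s : Fin m' → ℝ) :
    atomic (x ∘ e) (s ∘ e) = atomic x s :=
  e.sum_comp fun j => ENNReal.ofReal (s j) • Measure.dirac (x j)

/-- The mass at a singleton counts the indices lying over it. The fibres of the two enumerations are
thus equinumerous, and bijections between them glue together. -/
lemma exists_equiv_of_counting_eq [MeasurableSingletonClass X] {c c' : Config X}
    (h : c.counting = c'.counting) : ∃ e : Fin c.1 ≃ Fin c'.1, c.2 = c'.2 ∘ e := by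
  classical
  have hcard : ∀ (c : Config X) (x : X),
      c.counting {x} = (Fintype.card {j // c.2 j = x} : ℝ≥0∞) := fun c x => by
    rw [Fintype.card_subtype, Config.counting]
    simp only [Measure.coe_finsetSum, Finset.sum_apply, Measure.dirac_apply, Set.indicator_apply,
      Set.mem_singleton_iff, Pi.one_apply, Finset.sum_boole]
  have he : ∀ x, Nonempty ({j // c.2 j = x} ≃ {j // c'.2 j = x}) := fun x => by
    refine Fintype.card_eq.1 ?_
    have := hcard c x
    rw [h, hcard c' x] at this
    exact_mod_cast this.symm
  let e := fun x => (he x).some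
  refine ⟨(Equiv.sigmaFiberEquiv c.2).symm.trans
    ((Equiv.sigmaCongrRight e).trans (Equiv.sigmaFiberEquiv c'.2)), ?_⟩
  ext j
  exact (e (c.2 j) ⟨j, rfl⟩).2.symm

/-- Two enumerations of the same points differ by a permutation, and the law of i.i.d. marks is
invariant under permutations. -/
lemma rmKernel_eq_of_counting_eq [MeasurableSingletonClass X] {c c' : Config X}
    (h : c.counting = c'.counting) : rmKernel X H c = rmKernel X H c' := by
  obtain ⟨e, he⟩ := exists_equiv_of_counting_eq h
  have h1 := measurePreserving_piCongrLeft (fun _ : Fin c'.1 => H) e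
  rw [rmKernel_apply, rmKernel_apply, ← h1.map_eq, Measure.map_map (by fun_prop) h1.measurable]
  refine congrArg (Measure.map · _) (funext fun s => ?_)
  rw [Function.comp_apply, ← atomic_comp_equiv e, ← he]
  congr 1
  ext j
  rw [Function.comp_apply, MeasurableEquiv.piCongrLeft_apply_apply (β := fun _ => ℝ)]

/-- The law of the random measure depends only on the law of the counting measure. -/
lemma rmLaw_eq_of_map_counting_eq [StandardBorelSpace X] {Q Q' : Measure (Config X)}
    (h : Q.map Config.counting = Q'.map Config.counting) : rmLaw Q H = rmLaw Q' H := by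
  rw [rmLaw_eq_bind, rmLaw_eq_bind, Measure.bind, Measure.bind,
    map_eq_of_fibre_const measurable_counting (fun _ => inferInstance)
      (rmKernel X H).measurable (fun _ _ => rmKernel_eq_of_counting_eq) h]

end RandomMeasure

/-! ### The reduced Campbell measure and its disintegration -/

section ReducedPalm

section Disintegration

/-- Disintegration of a measure on a product whose first marginal is `σ`-finite. -/
lemma exists_disintegration {α Ω : Type*} [MeasurableSpace α] [MeasurableSpace Ω]
    [StandardBorelSpace Ω] [Nonempty Ω] (C : Measure (α × Ω)) [SigmaFinite C.fst] :
    ∃ Q : Kernel α Ω, IsMarkovKernel Q ∧ ∀ F : α × Ω → ℝ≥0∞, Measurable F →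
      ∫⁻ p, F p ∂C = ∫⁻ z, ∫⁻ c, F (z, c) ∂(Q z) ∂C.fst := by
  -- A positive weight with finite integral turns `C` into a finite measure, which has a conditional
  -- kernel. The weight depends on the first coordinate only, so it cancels afterwards.
  obtain ⟨w, hw0, hw, hwlt⟩ := exists_pos_lintegral_lt_of_sigmaFinite C.fst one_ne_zero
  have hw' : Measurable fun z => (w z : ℝ≥0∞) := hw.coe_nnreal_ennreal
  have hw1 : Measurable fun p : α × Ω => (w p.1 : ℝ≥0∞) := hw'.comp measurable_fst
  let Cw := C.withDensity fun p => (w p.1 : ℝ≥0∞)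
  have hCw : ∀ {g : α × Ω → ℝ≥0∞}, Measurable g → ∫⁻ p, g p ∂Cw = ∫⁻ p, w p.1 * g p ∂C :=
    fun hg => lintegral_withDensity_eq_lintegral_mul _ hw1 hg
  have hfin : IsFiniteMeasure Cw := by
    refine ⟨?_⟩
    rw [withDensity_apply _ MeasurableSet.univ, Measure.restrict_univ]
    rw [Measure.fst, lintegral_map hw' measurable_fst] at hwlt
    exact hwlt.trans ENNReal.one_lt_top
  refine ⟨Cw.condKernel, inferInstance, fun F hF => ?_⟩
  have hcancel : ∀ z, (w z : ℝ≥0∞) * (w z : ℝ≥0∞)⁻¹ = 1 := fun z =>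
    ENNReal.mul_inv_cancel (by simpa using (hw0 z).ne') ENNReal.coe_ne_top
  have hin : Measurable fun z => ∫⁻ c, F (z, c) ∂(Cw.condKernel z) :=
    hF.lintegral_kernel_prod_right'
  calc ∫⁻ p, F p ∂C = ∫⁻ p, w p.1 * ((w p.1 : ℝ≥0∞)⁻¹ * F p) ∂C := by
        simp only [← mul_assoc, hcancel, one_mul]
    _ = ∫⁻ p, (w p.1 : ℝ≥0∞)⁻¹ * F p ∂Cw := (hCw (by fun_prop)).symm
    _ = ∫⁻ p, (w p.1 : ℝ≥0∞)⁻¹ * F p ∂(Cw.fst ⊗ₘ Cw.condKernel) := by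
        rw [Cw.disintegrate]
    _ = ∫⁻ z, (w z : ℝ≥0∞)⁻¹ * ∫⁻ c, F (z, c) ∂(Cw.condKernel z) ∂Cw.fst := by
        rw [Measure.lintegral_compProd (by fun_prop)]
        refine lintegral_congr fun z => ?_
        exact lintegral_const_mul (w z : ℝ≥0∞)⁻¹ (f := fun c => F (z, c)) (by fun_prop)
    _ = ∫⁻ p, w p.1 * ((w p.1 : ℝ≥0∞)⁻¹ * ∫⁻ c, F (p.1, c) ∂(Cw.condKernel p.1)) ∂C := by
        have hm : Measurable fun z => (w z : ℝ≥0∞)⁻¹ * ∫⁻ c, F (z, c) ∂(Cw.condKernel z) :=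
          hw'.inv.mul hin
        rw [Measure.fst, lintegral_map hm measurable_fst]
        exact hCw (hm.comp measurable_fst)
    _ = _ := by
        simp only [← mul_assoc, hcancel, one_mul]
        rw [Measure.fst, lintegral_map hin measurable_fst]

end Disintegration

variable {X : Type*}

/-! ### Patterns of ties and embeddings of indices -/

section Combinatorics

/-- The vectors `z ∘ τ` with `z` a vector of pairwise distinct points. -/
def patternSet (X : Type*) {n k : ℕ} (τ : Fin n → Fin k) : Set (Fin n → X) :=
  {y | ∃ z : Fin k → X, Function.Injective z ∧ y = z ∘ τ}

/-- For distinct points, equalities among the selected points are equalities among their indices.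
Choosing one observation per label recovers the embedding. -/
lemma comp_mem_patternSet_iff {n k m : ℕ} {τ : Fin n → Fin k} (hτ : Function.Surjective τ)
    {x : Fin m → X} (hx : Function.Injective x) (i : Fin n → Fin m) :
    x ∘ i ∈ patternSet X τ ↔ ∃ a : Fin k ↪ Fin m, i = a ∘ τ := by
  constructor
  · rintro ⟨z, hz, hxi⟩
    have hl : ∀ l, x (i l) = z (τ l) := fun l => congrFun hxi l
    have hσ : ∀ j, τ (Function.surjInv hτ j) = j := Function.surjInv_eq hτ
    refine ⟨⟨fun j => i (Function.surjInv hτ j), fun j j' h => hz ?_⟩, funext fun l => hx ?_⟩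
    · have := congrArg x h
      rwa [hl, hl, hσ, hσ] at this
    · change x (i l) = x (i (Function.surjInv hτ (τ l)))
      rw [hl, hl, hσ]
  · rintro ⟨a, rfl⟩
    exact ⟨x ∘ a, hx.comp a.injective, rfl⟩

/-- This turns the sum over all index choices, which comes from a power of an atomic measure, into
the sum over embeddings that appears in the reduced Campbell measure. -/
lemma sum_eq_sum_embedding {n k m : ℕ} {τ : Fin n → Fin k} (hτ : Function.Surjective τ)
    {x : Fin m → X} (hx : Function.Injective x) (f : (Fin n → Fin m) → ℝ≥0∞)
    (hf : ∀ i, x ∘ i ∉ patternSet X τ → f i = 0) :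
    ∑ i, f i = ∑ a : Fin k ↪ Fin m, f (a ∘ τ) := by
  symm
  refine Fintype.sum_of_injective (fun a : Fin k ↪ Fin m => (a ∘ τ : Fin n → Fin m)) ?_ _ _ ?_
    fun _ => rfl
  · intro a b hab
    ext j
    obtain ⟨l, rfl⟩ := hτ j
    exact congrArg Fin.val (congrFun hab l)
  · intro i hi
    refine hf i fun h => hi ?_
    obtain ⟨a, ha⟩ := (comp_mem_patternSet_iff hτ hx i).1 h
    exact ⟨a, ha.symm⟩

open Classical in
/-- An enumeration of `Fin m` that begins with `a` and continues with the remaining indices. -/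
def restEquiv {k m : ℕ} (a : Fin k ↪ Fin m) : Fin k ⊕ Fin (m - k) ≃ Fin m :=
  ((Equiv.ofInjective a a.injective).sumCongr (Fintype.equivFinOfCardEq (by
    rw [Fintype.card_compl_set, Set.card_range_of_injective a.injective, Fintype.card_fin,
      Fintype.card_fin])).symm).trans
  (Equiv.Set.sumCompl (Set.range a))

lemma restEquiv_inl {k m : ℕ} (a : Fin k ↪ Fin m) (j : Fin k) : restEquiv a (Sum.inl j) = a j := by
  simp [restEquiv]

/-- The configuration `c` without the points with indices in the range of `a`. -/
def remove {k : ℕ} (c : Config X) (a : Fin k ↪ Fin c.1) : Config X :=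
  ⟨c.1 - k, fun j => c.2 (restEquiv a (Sum.inr j))⟩

end Combinatorics

/-- The tuples of pairwise distinct points. -/
def injSet (X : Type*) (k : ℕ) : Set (Fin k → X) := {z | Function.Injective z}

lemma injSet_eq_patternSet (k : ℕ) : injSet X k = patternSet X (id : Fin k → Fin k) := by
  ext z
  exact ⟨fun h => ⟨z, h, rfl⟩, fun ⟨z', h, e⟩ => by rw [e]; exact h⟩

variable [MeasurableSpace X]

lemma measurable_counting_add {k : ℕ} : Measurable fun p : (Fin k → X) × Config X =>
    p.2.counting + ∑ j, Measure.dirac (p.1 j) :=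
  measurable_measure_add (measurable_counting.comp measurable_snd)
    (measurable_sum_dirac.comp measurable_fst)

lemma measurable_campbellIntegrand {k : ℕ} {B : Set (Fin k → X)} (hB : MeasurableSet B)
    {L : Set (Measure X)} (hL : MeasurableSet L) :
    Measurable fun p : (Fin k → X) × Config X => B.indicator (1 : (Fin k → X) → ℝ≥0∞) p.1 *
      L.indicator 1 (p.2.counting + ∑ j, Measure.dirac (p.1 j)) :=
  ((measurable_one.indicator hB).comp measurable_fst).mul
    ((measurable_one.indicator hL).comp measurable_counting_add)

lemma add_right_cancel_of_isFiniteMeasure {μ ν ρ : Measure X} [IsFiniteMeasure ρ]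
    (h : μ + ρ = ν + ρ) : μ = ν := by
  ext A _
  have := congrArg (fun m : Measure X => m A) h
  exact (ENNReal.add_left_inj (measure_ne_top ρ A)).1 this

lemma counting_remove_add {k : ℕ} (c : Config X) (a : Fin k ↪ Fin c.1) :
    (remove c a).counting + ∑ j, Measure.dirac (c.2 (a j)) = c.counting := by
  rw [Config.counting, Config.counting, ← (restEquiv a).sum_comp fun j => Measure.dirac (c.2 j),
    Fintype.sum_sum_type, add_comm]
  simp only [restEquiv_inl]
  rfl

/-- The kernel whose composition with the law of `Φ` is the reduced Campbell measure. -/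
def removeKernel (X : Type*) [MeasurableSpace X] (k : ℕ) :
    Kernel (Config X) ((Fin k → X) × Config X) where
  toFun c := ∑ a : Fin k ↪ Fin c.1, Measure.dirac (c.2 ∘ a, remove c a)
  measurable' := by
    refine measurable_of_sigma fun m => Measure.measurable_of_measurable_coe _ fun A hA => ?_
    simp only [Measure.coe_finsetSum, Finset.sum_apply, Measure.dirac_apply' _ hA]
    have h1 : Measurable (A.indicator (1 : (Fin k → X) × Config X → ℝ≥0∞)) :=
      measurable_one.indicator hA
    change Measurable fun x : Fin m → X => ∑ a : Fin k ↪ Fin m, A.indicator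
      (1 : (Fin k → X) × Config X → ℝ≥0∞) (x ∘ a, remove (⟨m, x⟩ : Config X) a)
    refine Finset.measurable_sum _ fun a _ => h1.comp ?_
    refine Measurable.prodMk (measurable_pi_lambda _ fun j => measurable_pi_apply (a j)) ?_
    exact (measurable_sigma_mk (β := fun m => Fin m → X) (m - k)).comp
      (measurable_pi_lambda _ fun j => measurable_pi_apply (restEquiv a (Sum.inr j)))

/-- The reduced Campbell measure `E[∑_a 1{(x ∘ a, Φ - ∑_j δ_{x_{a j}}) ∈ ·}]`. -/
def reducedCampbell (P : Measure (Config X)) (k : ℕ) : Measure ((Fin k → X) × Config X) :=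
  P.bind (removeKernel X k)

lemma lintegral_reducedCampbell (P : Measure (Config X)) (k : ℕ)
    {F : (Fin k → X) × Config X → ℝ≥0∞} (hF : Measurable F) :
    ∫⁻ p, F p ∂(reducedCampbell P k) =
      ∫⁻ c, ∑ a : Fin k ↪ Fin c.1, F (c.2 ∘ a, remove c a) ∂P := by
  rw [reducedCampbell, Measure.lintegral_bind (removeKernel X k).aemeasurable hF.aemeasurable]
  refine lintegral_congr fun c => ?_
  change ∫⁻ p, F p ∂(∑ a : Fin k ↪ Fin c.1, Measure.dirac (c.2 ∘ a, remove c a)) = _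
  rw [lintegral_finsetSum_measure]
  simp only [lintegral_dirac' _ hF]

lemma pi_counting (k : ℕ) (c : Config X) : Measure.pi (fun _ : Fin k => c.counting) =
    ∑ i : Fin k → Fin c.1, Measure.dirac (c.2 ∘ i) := by
  have := pi_sum_smul_dirac (ι := Fin k) c.2 (fun _ => 1) fun _ => ENNReal.one_ne_top
  simp only [one_smul, Finset.prod_const_one] at this
  exact this

lemma lintegral_momentMeasure (P : Measure (Config X)) (k : ℕ) {f : (Fin k → X) → ℝ≥0∞}
    (hf : Measurable f) :
    ∫⁻ z, f z ∂(momentMeasure P k) = ∫⁻ c, ∑ i : Fin k → Fin c.1, f (c.2 ∘ i) ∂P := by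
  rw [momentMeasure, Measure.lintegral_bind (Measurable.aemeasurable ?_) hf.aemeasurable]
  · refine lintegral_congr fun c => ?_
    rw [pi_counting, lintegral_finsetSum_measure]
    simp only [lintegral_dirac' _ hf]
  · exact measurable_measure_pi measurable_counting

/-- On tuples of distinct points, Φ^k counts the embeddings, and putting the selected points back
into the remaining configuration restores Φ. -/
lemma campbell_eq_lintegral {P : Measure (Config X)}
    (hsimple : ∀ᵐ c ∂P, Function.Injective c.2) {k : ℕ}
    {B : Set (Fin k → X)} (hB : MeasurableSet B) (hBinj : B ⊆ injSet X k)
    {L : Set (Measure X)} (hL : MeasurableSet L) :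
    campbell P k B L = ∫⁻ p, B.indicator 1 p.1 *
      L.indicator 1 (p.2.counting + ∑ j, Measure.dirac (p.1 j)) ∂(reducedCampbell P k) := by
  rw [lintegral_reducedCampbell P k (measurable_campbellIntegrand hB hL), campbell]
  refine lintegral_congr_ae ?_
  filter_upwards [hsimple] with c hc
  have h1 : ∀ a : Fin k ↪ Fin c.1,
      (remove c a).counting + ∑ j, Measure.dirac ((c.2 ∘ a) j) = c.counting :=
    counting_remove_add c
  simp only [h1]
  rw [← Finset.sum_mul, mul_comm, pi_counting]
  congr 1
  simp only [Measure.coe_finsetSum, Finset.sum_apply, Measure.dirac_apply' _ hB]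
  rw [sum_eq_sum_embedding (τ := id) Function.surjective_id hc]
  · rfl
  · intro i hi
    rw [← injSet_eq_patternSet] at hi
    exact Set.indicator_of_notMem (fun h => hi (hBinj h)) _

/-- Disintegrating the full reduced Campbell measure on configurations is stronger than the Palm
identity, which tests only sets of counting measures. -/
lemma isReducedPalmKernel_of_lintegral {P : Measure (Config X)}
    (hsimple : ∀ᵐ c ∂P, Function.Injective c.2) {k : ℕ}
    {Q : Kernel (Fin k → X) (Config X)} [IsMarkovKernel Q]
    (hQ : ∀ F : (Fin k → X) × Config X → ℝ≥0∞, Measurable F → ∫⁻ p, F p ∂(reducedCampbell P k) =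
        ∫⁻ z in injSet X k, ∫⁻ c, F (z, c) ∂(Q z) ∂(momentMeasure P k)) :
    IsReducedPalmKernel P k Q := by
  refine ⟨inferInstance, fun B hB hBinj L hL => ?_⟩
  rw [campbell_eq_lintegral hsimple hB hBinj hL, hQ _ (measurable_campbellIntegrand hB hL)]
  rw [← Set.inter_eq_left.2 (show B ⊆ injSet X k from hBinj), ← Measure.restrict_restrict hB,
    ← lintegral_indicator hB]
  rw [Set.inter_eq_left.2 (show B ⊆ injSet X k from hBinj)]
  refine lintegral_congr fun z => ?_
  have hLz : MeasurableSet {c : Config X | c.counting + ∑ j, Measure.dirac (z j) ∈ L} :=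
    (measurable_counting_add.comp measurable_prodMk_left) hL
  by_cases hz : z ∈ B
  · simp only [Set.indicator_of_mem hz, Pi.one_apply, one_mul]
    rw [← lintegral_indicator_one hLz]
    rfl
  · simp [Set.indicator_of_notMem hz]

/-! ### Existence and uniqueness of reduced Palm kernels -/

section Palm

variable [StandardBorelSpace X]

lemma measurableSet_injSet (k : ℕ) : MeasurableSet (injSet X k) := by
  have : injSet X k = ⋂ i, ⋂ j, {z : Fin k → X | z i = z j → i = j} := by
    ext z
    simp [injSet, Function.Injective]
  rw [this]
  refine MeasurableSet.iInter fun i => MeasurableSet.iInter fun j => ?_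
  by_cases h : i = j
  · simp [h]
  · simp only [h, imp_false]
    exact (measurableSet_eq_fun (measurable_pi_apply i) (measurable_pi_apply j)).compl

variable {P : Measure (Config X)}

lemma setLIntegral_momentMeasure (hsimple : ∀ᵐ c ∂P, Function.Injective c.2) {k : ℕ}
    {f : (Fin k → X) → ℝ≥0∞} (hf : Measurable f) :
    ∫⁻ z in injSet X k, f z ∂(momentMeasure P k) = ∫⁻ p, f p.1 ∂(reducedCampbell P k) := by
  rw [← lintegral_indicator (measurableSet_injSet k), lintegral_momentMeasure P k
    (hf.indicator (measurableSet_injSet k)), lintegral_reducedCampbell P k (by fun_prop)]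
  refine lintegral_congr_ae ?_
  filter_upwards [hsimple] with c hc
  rw [sum_eq_sum_embedding (τ := id) Function.surjective_id hc]
  · refine Finset.sum_congr rfl fun a _ => ?_
    exact Set.indicator_of_mem (show _ ∈ injSet X k from hc.comp a.injective) f
  · intro i hi
    rw [← injSet_eq_patternSet] at hi
    exact Set.indicator_of_notMem hi f

/-- Simplicity identifies sums over embeddings with sums over distinct tuples. The σ-finiteness of
the moment measure thus passes to the marginal that is to be disintegrated. -/
lemma fst_reducedCampbell (hsimple : ∀ᵐ c ∂P, Function.Injective c.2) (k : ℕ) :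
    (reducedCampbell P k).fst = (momentMeasure P k).restrict (injSet X k) := by
  ext s hs
  have h := setLIntegral_momentMeasure hsimple (k := k) (measurable_one.indicator hs)
  rw [lintegral_indicator_one hs] at h
  rw [h, Measure.fst_apply hs, ← lintegral_indicator_one (measurable_fst hs)]
  rfl

lemma exists_kernel_lintegral_reducedCampbell (hsimple : ∀ᵐ c ∂P, Function.Injective c.2) (k : ℕ)
    [SigmaFinite (momentMeasure P k)] :
    ∃ Q : Kernel (Fin k → X) (Config X), IsMarkovKernel Q ∧
      ∀ F : (Fin k → X) × Config X → ℝ≥0∞, Measurable F → ∫⁻ p, F p ∂(reducedCampbell P k) =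
        ∫⁻ z in injSet X k, ∫⁻ c, F (z, c) ∂(Q z) ∂(momentMeasure P k) := by
  have : Nonempty (Config X) := ⟨⟨0, Fin.elim0⟩⟩
  have hfst := fst_reducedCampbell hsimple k
  have : SigmaFinite (reducedCampbell P k).fst := hfst ▸ inferInstance
  obtain ⟨Q, hQ, h⟩ := exists_disintegration (reducedCampbell P k)
  exact ⟨Q, hQ, fun F hF => by rw [h F hF, hfst]⟩

/-- Any two versions of the reduced Palm kernel give the same law of the counting measure. -/
lemma ae_map_counting_eq {k : ℕ} [SigmaFinite (momentMeasure P k)]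
    {Q Q' : Kernel (Fin k → X) (Config X)} (hQ : IsReducedPalmKernel P k Q)
    (hQ' : IsReducedPalmKernel P k Q') :
    ∀ᵐ z ∂((momentMeasure P k).restrict (injSet X k)),
      (Q z).map Config.counting = (Q' z).map Config.counting := by
  have := hQ.isMarkovKernel
  have := hQ'.isMarkovKernel
  -- These countably many events determine the law of a random finite measure, so a single null set
  -- serves for all of them.
  let L : ℚ → Set (Measure X) := fun q => code X ⁻¹' Set.Iio (q : ℝ)
  have hL : ∀ q, MeasurableSet (L q) := fun q => measurable_code measurableSet_Iio
  have hmeas : ∀ (R : Kernel (Fin k → X) (Config X)) [IsMarkovKernel R] (q : ℚ),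
      Measurable fun z => R z {c | c.counting + ∑ j, Measure.dirac (z j) ∈ L q} :=
    fun R _ q => Kernel.measurable_kernel_prodMk_left (measurable_counting_add (hL q))
  have hae : ∀ q : ℚ, ∀ᵐ z ∂((momentMeasure P k).restrict (injSet X k)),
      Q z {c | c.counting + ∑ j, Measure.dirac (z j) ∈ L q} =
        Q' z {c | c.counting + ∑ j, Measure.dirac (z j) ∈ L q} := fun q => by
    refine ae_eq_of_forall_setLIntegral_eq_of_sigmaFinite (hmeas Q q) (hmeas Q' q)
      fun s hs _ => ?_
    rw [Measure.restrict_restrict hs]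
    have hm := hs.inter (measurableSet_injSet (X := X) k)
    rw [← hQ.campbell_eq _ hm (fun z hz => hz.2) _ (hL q),
      ← hQ'.campbell_eq _ hm (fun z hz => hz.2) _ (hL q)]
  filter_upwards [ae_all_iff.2 hae] with z hz
  have hf : Measurable fun c : Config X => c.counting + ∑ j, Measure.dirac (z j) :=
    measurable_counting_add.comp measurable_prodMk_left
  have hprob : ∀ R : Kernel (Fin k → X) (Config X), IsMarkovKernel R →
      IsProbabilityMeasure ((R z).map fun c => c.counting + ∑ j, Measure.dirac (z j)) :=
    fun R _ => Measure.isProbabilityMeasure_map hf.aemeasurable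
  have hfin : ∀ R : Kernel (Fin k → X) (Config X), IsMarkovKernel R →
      ∀ᵐ μ ∂((R z).map fun c => c.counting + ∑ j, Measure.dirac (z j)), IsFiniteMeasure μ :=
    fun R _ => (ae_map_iff hf.aemeasurable measurableSet_isFiniteMeasure).2
      (Filter.Eventually.of_forall fun c => inferInstance)
  have := hprob Q inferInstance
  have := hprob Q' inferInstance
  -- The laws agree after the points `z` have been added. Adding a finite measure is injective, so
  -- the laws without these points agree too.
  refine map_eq_of_fibre_const hf (fun _ => inferInstance) measurable_counting
    (fun c c' h => add_right_cancel_of_isFiniteMeasure h)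
    (ext_of_code (hfin Q inferInstance) (hfin Q' inferInstance) fun q => ?_)
  rw [Measure.map_apply hf (hL q), Measure.map_apply hf (hL q)]
  exact hz q

/-- For every version `Q` of the reduced Palm kernel, the reduced Campbell measure disintegrates
through `Q` on functions of the marked points. -/
lemma lintegral_reducedCampbell_rmKernel {H : Measure ℝ} [IsProbabilityMeasure H]
    (hsimple : ∀ᵐ c ∂P, Function.Injective c.2) {k : ℕ} [SigmaFinite (momentMeasure P k)]
    {Q : Kernel (Fin k → X) (Config X)} (hQ : IsReducedPalmKernel P k Q)
    {G : (Fin k → X) × Measure X → ℝ≥0∞} (hG : Measurable G) :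
    ∫⁻ p, ∫⁻ μ, G (p.1, μ) ∂(rmKernel X H p.2) ∂(reducedCampbell P k) =
      ∫⁻ z in injSet X k, ∫⁻ μ, G (z, μ) ∂(rmLaw (Q z) H) ∂(momentMeasure P k) := by
  -- The identity holds for a kernel `Q₀` that disintegrates on configurations. It passes to `Q`
  -- because attaching marks uses only the law of the counting measure, which is almost everywhere
  -- the same for both.
  obtain ⟨Q₀, hQ₀, h⟩ := exists_kernel_lintegral_reducedCampbell hsimple k
  have hm : Measurable fun p : (Fin k → X) × Config X =>
      ∫⁻ μ, G (p.1, μ) ∂(rmKernel X H p.2) :=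
    Measurable.lintegral_kernel_prod_right (κ := (rmKernel X H).comap Prod.snd measurable_snd)
      (f := fun p μ => G (p.1, μ)) (by unfold Function.uncurry; fun_prop)
  rw [h _ hm]
  refine lintegral_congr_ae ?_
  filter_upwards [ae_map_counting_eq hQ (isReducedPalmKernel_of_lintegral hsimple h)] with z hz
  rw [rmLaw_eq_of_map_counting_eq hz, lintegral_rmLaw _ (by fun_prop)]

end Palm

end ReducedPalm

/-! ### The negative exponential on the extended half-line -/

section ExpNeg

/-- The function `e^{-a}` on `[0, ∞]`. -/
def expNeg (a : ℝ≥0∞) : ℝ≥0∞ := EReal.exp (-(a : EReal))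

lemma expNeg_eq_inv (a : ℝ≥0∞) : expNeg a = (EReal.exp (a : EReal))⁻¹ := EReal.exp_neg _

lemma expNeg_add (a b : ℝ≥0∞) : expNeg (a + b) = expNeg a * expNeg b := by
  rw [expNeg_eq_inv, expNeg_eq_inv, expNeg_eq_inv, EReal.coe_ennreal_add, EReal.exp_add,
    ENNReal.mul_inv]
  · exact Or.inl (by simp)
  · exact Or.inr (by simp)

lemma expNeg_sum {ι : Type*} (s : Finset ι) (a : ι → ℝ≥0∞) :
    expNeg (∑ i ∈ s, a i) = ∏ i ∈ s, expNeg (a i) := by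
  classical
  induction s using Finset.induction_on with
  | empty => simp [expNeg]
  | insert i s hi ih => rw [Finset.sum_insert hi, Finset.prod_insert hi, expNeg_add, ih]

lemma expNeg_le_one (a : ℝ≥0∞) : expNeg a ≤ 1 := by
  simp [expNeg, EReal.coe_ennreal_nonneg]

lemma expNeg_ne_zero {a : ℝ≥0∞} (ha : a ≠ ∞) : expNeg a ≠ 0 := by
  simp [expNeg, ha]

lemma expNeg_ofReal {t : ℝ} (ht : 0 ≤ t) :
    expNeg (ENNReal.ofReal t) = ENNReal.ofReal (Real.exp (-t)) := by
  rw [expNeg, EReal.coe_ennreal_ofReal, max_eq_left ht, ← EReal.coe_neg, EReal.exp_coe]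

@[fun_prop]
lemma measurable_expNeg : Measurable expNeg := by
  refine Antitone.measurable fun a b h => EReal.exp_monotone ?_
  exact EReal.neg_le_neg_iff.2 (EReal.coe_ennreal_le_coe_ennreal_iff.2 h)

lemma laplace_eq {X : Type*} [MeasurableSpace X] (ρ : Measure (Measure X)) (f : X → ℝ≥0) :
    laplace ρ f = ∫⁻ μ, expNeg (∫⁻ z, f z ∂μ) ∂ρ := rfl

end ExpNeg

/-! ### Sampling and the gamma auxiliary variable -/

section Observation

variable {X : Type*} [MeasurableSpace X]

lemma normalized_univ_le_one (μ : Measure X) : normalized μ Set.univ ≤ 1 := by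
  rw [normalized, Measure.smul_apply, smul_eq_mul]
  exact ENNReal.inv_mul_le_one _

instance (μ : Measure X) : IsFiniteMeasure (normalized μ) :=
  ⟨(normalized_univ_le_one μ).trans_lt ENNReal.one_lt_top⟩

lemma measurable_normalized : Measurable (normalized : Measure X → Measure X) := by
  refine Measure.measurable_of_measurable_coe _ fun A hA => ?_
  exact (Measure.measurable_coe MeasurableSet.univ).inv.mul (Measure.measurable_coe hA)

/-- `n` i.i.d. observations from the normalized measure. -/
def sampleKernel (X : Type*) [MeasurableSpace X] (n : ℕ) : Kernel (Measure X) (Fin n → X) where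
  toFun μ := Measure.pi fun _ : Fin n => normalized μ
  measurable' := measurable_measure_pi measurable_normalized

instance (n : ℕ) : IsFiniteKernel (sampleKernel X n) := by
  refine ⟨1, ENNReal.one_lt_top, fun μ => ?_⟩
  change Measure.pi (fun _ : Fin n => normalized μ) Set.univ ≤ 1
  rw [Measure.pi_univ]
  exact Finset.prod_le_one' fun _ _ => normalized_univ_le_one μ

lemma measurable_gammaPDF (a : ℝ) : Measurable fun p : ℝ × ℝ => gammaPDF a p.1 p.2 := by
  refine ENNReal.measurable_ofReal.comp (Measurable.ite ?_ ?_ measurable_const)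
  · exact measurable_snd measurableSet_Ici
  · fun_prop

/-- A gamma variable with shape `n` and rate the total mass. -/
def gammaKernel (X : Type*) [MeasurableSpace X] (n : ℕ) : Kernel (Measure X) ℝ where
  toFun μ := gammaMeasure n (μ Set.univ).toReal
  measurable' := by
    refine Measure.measurable_of_measurable_coe _ fun A hA => ?_
    simp only [gammaMeasure, withDensity_apply _ hA]
    have h : Measurable fun p : ℝ × ℝ => gammaPDF n p.1 p.2 := measurable_gammaPDF n
    have h1 : Measurable fun r : ℝ => ∫⁻ x in A, gammaPDF n r x := h.lintegral_prod_right'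
    exact h1.comp (Measure.measurable_coe MeasurableSet.univ).ennreal_toReal

lemma gammaMeasure_univ_le_one (n : ℕ) {r : ℝ} (hr : 0 ≤ r) :
    gammaMeasure n r Set.univ ≤ 1 := by
  rw [gammaMeasure, withDensity_apply _ MeasurableSet.univ, Measure.restrict_univ]
  -- In the degenerate cases, shape zero (where the Gamma function takes the value 0 and division by
  -- it gives 0) or rate zero, the density vanishes and the mass is 0 rather than 1.
  rcases n.eq_zero_or_pos with rfl | hn
  · simp [gammaPDF, gammaPDFReal, Real.Gamma_zero]
  · rcases hr.eq_or_lt with rfl | hr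
    · simp [gammaPDF, gammaPDFReal, Real.zero_rpow (Nat.cast_ne_zero.2 hn.ne')]
    · rw [lintegral_gammaPDF_eq_one (by exact_mod_cast hn) hr]

instance (n : ℕ) : IsFiniteKernel (gammaKernel X n) :=
  ⟨1, ENNReal.one_lt_top, fun _ => gammaMeasure_univ_le_one n ENNReal.toReal_nonneg⟩

/-- The law of `((Y, U_n), μ)` given `μ`, as a kernel. -/
def obsKernel (X : Type*) [MeasurableSpace X] (n : ℕ) :
    Kernel (Measure X) (((Fin n → X) × ℝ) × Measure X) :=
  (sampleKernel X n ×ₖ gammaKernel X n) ×ₖ Kernel.id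

instance (n : ℕ) : IsFiniteKernel (obsKernel X n) := by
  unfold obsKernel
  infer_instance

lemma obsKernel_apply (n : ℕ) (μ : Measure X) : obsKernel X n μ =
    ((Measure.pi fun _ : Fin n => normalized μ).prod
      (gammaMeasure n (μ Set.univ).toReal)).prod (Measure.dirac μ) := by
  rw [obsKernel, Kernel.prod_apply, Kernel.prod_apply, Kernel.id_apply]
  rfl

lemma jointLaw_eq_bind (P : Measure (Config X)) (H : Measure ℝ) (n : ℕ) :
    jointLaw P H n = (rmLaw P H).bind (obsKernel X n) := by
  simp only [jointLaw, ← obsKernel_apply]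

variable {H : Measure ℝ} [IsProbabilityMeasure H]

instance (P : Measure (Config X)) [IsProbabilityMeasure P] (n : ℕ) :
    IsFiniteMeasure (jointLaw P H n) := by
  rw [jointLaw_eq_bind]
  infer_instance

lemma lintegral_obsKernel {n : ℕ} (μ : Measure X)
    {F : ((Fin n → X) × ℝ) × Measure X → ℝ≥0∞} (hF : Measurable F) :
    ∫⁻ p, F p ∂(obsKernel X n μ) = ∫⁻ y, ∫⁻ u, F ((y, u), μ)
      ∂(gammaMeasure n (μ Set.univ).toReal) ∂(Measure.pi fun _ : Fin n => normalized μ) := by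
  have : SFinite (gammaMeasure n (μ Set.univ).toReal) := by
    unfold gammaMeasure
    infer_instance
  rw [obsKernel_apply, lintegral_prod _ hF.aemeasurable]
  refine (lintegral_congr fun q =>
    lintegral_dirac' μ (hF.comp (measurable_prodMk_left (x := q)))).trans ?_
  exact lintegral_prod (fun q => F (q, μ)) (by fun_prop)

/-- The density of a gamma law, up to the power of the rate and the exponential. -/
def gammaWeight (n : ℕ) (u : ℝ) : ℝ≥0∞ :=
  ENNReal.ofReal (u ^ (n - 1)) * ENNReal.ofReal (Real.Gamma n)⁻¹

@[fun_prop]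
lemma measurable_gammaWeight (n : ℕ) : Measurable (gammaWeight n) := by
  unfold gammaWeight
  fun_prop

/-- This cancellation is the purpose of the auxiliary variable: the rate power T^n in the gamma
density removes the normalization of the `n` observations. -/
lemma inv_pow_mul_gammaPDF {n : ℕ} (hn : 1 ≤ n) {T : ℝ≥0∞} (h0 : T ≠ 0) (hT : T ≠ ∞) {u : ℝ}
    (hu : 0 < u) : T⁻¹ ^ n * gammaPDF n T.toReal u =
      gammaWeight n u * expNeg (ENNReal.ofReal u * T) := by
  obtain ⟨t, rfl⟩ : ∃ t : ℝ, T = ENNReal.ofReal t := ⟨_, (ENNReal.ofReal_toReal hT).symm⟩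
  have ht : 0 < t := ENNReal.ofReal_pos.1 (pos_iff_ne_zero.2 h0)
  have hG : 0 < Real.Gamma n := Real.Gamma_pos_of_pos (by exact_mod_cast hn)
  rw [ENNReal.toReal_ofReal ht.le, gammaPDF_of_nonneg hu.le, ← ENNReal.ofReal_inv_of_pos ht,
    ← ENNReal.ofReal_pow (by positivity), ← ENNReal.ofReal_mul hu.le,
    expNeg_ofReal (by positivity), gammaWeight, ← ENNReal.ofReal_mul (by positivity),
    ← ENNReal.ofReal_mul (by positivity), ← ENNReal.ofReal_mul (by positivity)]
  congr 1
  have h1 : u ^ ((n : ℝ) - 1) = u ^ (n - 1) := by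
    rw [← Real.rpow_natCast, Nat.cast_sub hn, Nat.cast_one]
  rw [h1, Real.rpow_natCast, mul_comm t u]
  rw [inv_pow]
  field_simp

lemma atomic_univ {m : ℕ} (x : Fin m → X) (s : Fin m → ℝ) :
    atomic x s Set.univ = ∑ j, ENNReal.ofReal (s j) := by
  simp [atomic, Measure.coe_finsetSum]

lemma inv_pow_mul_lintegral_gammaMeasure {n : ℕ} (hn : 1 ≤ n) {T : ℝ≥0∞} (h0 : T ≠ 0)
    (hT : T ≠ ∞) {g : ℝ → ℝ≥0∞} (hg : Measurable g) :
    T⁻¹ ^ n * ∫⁻ u, g u ∂(gammaMeasure n T.toReal) =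
      ∫⁻ u in Set.Ioi 0, gammaWeight n u * (expNeg (ENNReal.ofReal u * T) * g u) := by
  have hpdf : Measurable (gammaPDF n T.toReal) :=
    (measurable_gammaPDF n).comp measurable_prodMk_left
  rw [gammaMeasure, lintegral_withDensity_eq_lintegral_mul _ hpdf hg,
    ← lintegral_const_mul _ (hpdf.mul hg), ← lintegral_indicator measurableSet_Ioi]
  refine lintegral_congr_ae ?_
  filter_upwards [compl_mem_ae_iff.2 (measure_singleton (μ := (volume : Measure ℝ)) 0)] with u hu
  rcases lt_or_gt_of_ne (show u ≠ 0 from hu) with h | h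
  · simp [Set.indicator, h.le, gammaPDF_of_neg h, not_lt]
  · rw [Set.indicator_of_mem (Set.mem_Ioi.2 h), Pi.mul_apply, ← mul_assoc,
      inv_pow_mul_gammaPDF hn h0 hT h, mul_assoc]

/-- The law of the observations given a measure with finitely many atoms. -/
lemma lintegral_obsKernel_atomic {n m : ℕ} (hn : 1 ≤ n) (x : Fin m → X) {s : Fin m → ℝ}
    (hs : ∀ j, 0 < s j) {F : ((Fin n → X) × ℝ) × Measure X → ℝ≥0∞} (hF : Measurable F) :
    ∫⁻ p, F p ∂(obsKernel X n (atomic x s)) = ∑ i : Fin n → Fin m,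
      (∏ l, ENNReal.ofReal (s (i l))) * ∫⁻ u in Set.Ioi 0, gammaWeight n u *
        (expNeg (ENNReal.ofReal u * atomic x s Set.univ) * F ((x ∘ i, u), atomic x s)) := by
  -- The total mass is nonzero only if there is a point. When `m = 0` there is no index map because
  -- `1 ≤ n`, so both sides vanish.
  have hT0 : ∀ _ : Fin m, atomic x s Set.univ ≠ 0 := fun j h => by
    rw [atomic_univ, Finset.sum_eq_zero_iff] at h
    exact (ENNReal.ofReal_pos.2 (hs j)).ne' (h j (Finset.mem_univ j))
  have hT : atomic x s Set.univ ≠ ∞ := measure_ne_top _ _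
  have hnorm : normalized (atomic x s) =
      ∑ j, ((atomic x s Set.univ)⁻¹ * ENNReal.ofReal (s j)) • Measure.dirac (x j) := by
    rw [normalized]
    nth_rw 2 [atomic]
    rw [Finset.smul_sum]
    simp only [smul_smul]
  have : SFinite (gammaMeasure n (atomic x s Set.univ).toReal) := by
    unfold gammaMeasure
    infer_instance
  have hm : Measurable fun y : Fin n → X => ∫⁻ u, F ((y, u), atomic x s)
      ∂(gammaMeasure n (atomic x s Set.univ).toReal) :=
    Measurable.lintegral_prod_right' (f := fun q : (Fin n → X) × ℝ => F (q, atomic x s))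
      (by fun_prop)
  rw [lintegral_obsKernel _ hF, hnorm, pi_sum_smul_dirac x _ fun j =>
    ENNReal.mul_ne_top (ENNReal.inv_ne_top.2 (hT0 j)) ENNReal.ofReal_ne_top,
    lintegral_finsetSum_measure]
  refine Finset.sum_congr rfl fun i _ => ?_
  rw [lintegral_smul_measure, lintegral_dirac' _ hm, smul_eq_mul, Finset.prod_mul_distrib,
    Finset.prod_const, Finset.card_univ, Fintype.card_fin, mul_comm (_ ^ n), mul_assoc,
    inv_pow_mul_lintegral_gammaMeasure hn (hT0 (i ⟨0, hn⟩)) hT (by fun_prop)]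

end Observation

/-! ### Factorization of the weight over observed and remaining points -/

section Marginal

variable {X : Type*} [MeasurableSpace X]

/-- The unnormalized density `e^{-us} s^m` of a jump with respect to `H`. -/
def jumpWeight (u : ℝ) (m : ℕ) (s : ℝ) : ℝ≥0∞ :=
  expNeg (ENNReal.ofReal u * ENNReal.ofReal s) * ENNReal.ofReal s ^ m

@[fun_prop]
lemma measurable_jumpWeight {β : Type*} [MeasurableSpace β] {m : ℕ} {u s : β → ℝ}
    (hu : Measurable u) (hs : Measurable s) : Measurable fun b => jumpWeight (u b) m (s b) := by
  unfold jumpWeight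
  fun_prop

/-- The weight of the jumps `s` and of the rest `μ`, times `F`. -/
def palmIntegrand {n k : ℕ} (τ : Fin n → Fin k) (F : ((Fin n → X) × ℝ) × Measure X → ℝ≥0∞)
    (z : Fin k → X) (u : ℝ) (s : Fin k → ℝ) (μ : Measure X) : ℝ≥0∞ :=
  (∏ j, jumpWeight u (count τ j) (s j)) * expNeg (ENNReal.ofReal u * μ Set.univ) *
    F ((z ∘ τ, u), atomic z s + μ)

lemma Measurable.palmIntegrand {β : Type*} [MeasurableSpace β] {n k : ℕ} (τ : Fin n → Fin k)
    {F : ((Fin n → X) × ℝ) × Measure X → ℝ≥0∞} (hF : Measurable F) {z : β → Fin k → X}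
    (hz : Measurable z) {u : β → ℝ} (hu : Measurable u) {s : β → Fin k → ℝ} (hs : Measurable s)
    {μ : β → Measure X} (hμ : Measurable μ) :
    Measurable fun b => palmIntegrand τ F (z b) (u b) (s b) (μ b) := by
  have h1 : Measurable fun b => μ b Set.univ := (Measure.measurable_coe MeasurableSet.univ).comp hμ
  have h2 : Measurable fun b => NRM.atomic (z b) (s b) + μ b :=
    measurable_measure_add (Measurable.atomic hz hs) hμ
  have h3 : Measurable fun b => z b ∘ τ :=
    measurable_pi_lambda _ fun l => (measurable_pi_apply (τ l)).comp hz
  have h4 : Measurable fun b => F ((z b ∘ τ, u b), NRM.atomic (z b) (s b) + μ b) :=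
    hF.comp ((h3.prodMk hu).prodMk h2)
  unfold NRM.palmIntegrand
  fun_prop

lemma atomic_split {k : ℕ} (c : Config X) (a : Fin k ↪ Fin c.1) (s : Fin k → ℝ)
    (t : Fin (c.1 - k) → ℝ) :
    atomic c.2 (Sum.elim s t ∘ (restEquiv a).symm) = atomic (c.2 ∘ a) s + atomic (remove c a).2 t
    := by
  rw [atomic, ← (restEquiv a).sum_comp, Fintype.sum_sum_type]
  simp only [Function.comp_apply, Equiv.symm_apply_apply, Sum.elim_inl, Sum.elim_inr]
  simp only [restEquiv_inl]
  rfl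

/-- Grouping the observations by label turns the product of their marks into powers with exponents
n_j. The exponential of the total mass is multiplicative over the two blocks of points. -/
lemma prod_mul_expNeg_split {n k : ℕ} (τ : Fin n → Fin k) (c : Config X) (a : Fin k ↪ Fin c.1)
    (s : Fin k → ℝ) (t : Fin (c.1 - k) → ℝ) (u : ℝ) :
    (∏ l, ENNReal.ofReal ((Sum.elim s t ∘ (restEquiv a).symm) (a (τ l)))) *
      expNeg (ENNReal.ofReal u * (atomic c.2 (Sum.elim s t ∘ (restEquiv a).symm)) Set.univ) =
    (∏ j, jumpWeight u (count τ j) (s j)) *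
      expNeg (ENNReal.ofReal u * atomic (remove c a).2 t Set.univ) := by
  have h1 : ∀ l, (Sum.elim s t ∘ (restEquiv a).symm) (a (τ l)) = s (τ l) := fun l => by
    rw [Function.comp_apply, ← restEquiv_inl, Equiv.symm_apply_apply, Sum.elim_inl]
  have h2 : ∏ l, ENNReal.ofReal (s (τ l)) = ∏ j, ENNReal.ofReal (s j) ^ count τ j := by
    rw [← Finset.prod_fiberwise Finset.univ τ]
    refine Finset.prod_congr rfl fun j _ => ?_
    rw [count, ← Finset.prod_const]
    refine Finset.prod_congr rfl fun l hl => ?_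
    rw [(Finset.mem_filter.1 hl).2]
  simp only [h1, h2, jumpWeight]
  rw [atomic_split , Measure.add_apply, mul_add, expNeg_add, atomic_univ (c.2 ∘ a),
    Finset.mul_sum, expNeg_sum, Finset.prod_mul_distrib]
  ring

end Marginal

/-! ### The joint law through the reduced Palm kernel -/

section KeyFormula

variable {X : Type*} [MeasurableSpace X] {H : Measure ℝ} [IsProbabilityMeasure H]

lemma measurable_lintegral_rmKernel {β : Type*} [MeasurableSpace β] {c : β → Config X}
    (hc : Measurable c) {g : β × Measure X → ℝ≥0∞} (hg : Measurable g) :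
    Measurable fun b => ∫⁻ μ, g (b, μ) ∂(rmKernel X H (c b)) :=
  Measurable.lintegral_kernel_prod_right' (κ := (rmKernel X H).comap c hc) hg

/-- The integral of `palmIntegrand` over the auxiliary variable and the jumps. -/
def palmMarginal (H : Measure ℝ) {n k : ℕ} (τ : Fin n → Fin k)
    (F : ((Fin n → X) × ℝ) × Measure X → ℝ≥0∞) (q : (Fin k → X) × Measure X) : ℝ≥0∞ :=
  ∫⁻ u in Set.Ioi 0, gammaWeight n u *
    ∫⁻ s, palmIntegrand τ F q.1 u s q.2 ∂(Measure.pi fun _ : Fin k => H)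

lemma measurable_palmMarginal_aux {n k : ℕ} (τ : Fin n → Fin k)
    {F : ((Fin n → X) × ℝ) × Measure X → ℝ≥0∞} (hF : Measurable F) :
    Measurable fun q : ((Fin k → X) × Measure X) × ℝ => gammaWeight n q.2 *
      ∫⁻ s, palmIntegrand τ F q.1.1 q.2 s q.1.2 ∂(Measure.pi fun _ : Fin k => H) := by
  have hm : Measurable fun q : (((Fin k → X) × Measure X) × ℝ) × (Fin k → ℝ) =>
      palmIntegrand τ F q.1.1.1 q.1.2 q.2 q.1.1.2 :=
    Measurable.palmIntegrand τ hF (by fun_prop) (by fun_prop) (by fun_prop) (by fun_prop)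
  exact Measurable.mul (by fun_prop) hm.lintegral_prod_right'

lemma measurable_palmMarginal {n k : ℕ} (τ : Fin n → Fin k)
    {F : ((Fin n → X) × ℝ) × Measure X → ℝ≥0∞} (hF : Measurable F) :
    Measurable (palmMarginal H τ F) :=
  (measurable_palmMarginal_aux τ hF).lintegral_prod_right'

lemma palmMarginal_eq {n k : ℕ} (τ : Fin n → Fin k)
    {F : ((Fin n → X) × ℝ) × Measure X → ℝ≥0∞} (hF : Measurable F) (z : Fin k → X)
    (μ : Measure X) : palmMarginal H τ F (z, μ) = ∫⁻ s, (∫⁻ u in Set.Ioi 0, gammaWeight n u *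
      palmIntegrand τ F z u s μ) ∂(Measure.pi fun _ : Fin k => H) := by
  have hm : Measurable fun q : (Fin k → ℝ) × ℝ =>
      gammaWeight n q.2 * palmIntegrand τ F z q.2 q.1 μ :=
    Measurable.mul (by fun_prop) (Measurable.palmIntegrand τ hF (by fun_prop) (by fun_prop)
      (by fun_prop) (by fun_prop))
  rw [palmMarginal, lintegral_lintegral_swap hm.aemeasurable]
  refine lintegral_congr fun u => (lintegral_const_mul _ ?_).symm
  exact Measurable.palmIntegrand τ hF (by fun_prop) (by fun_prop) (by fun_prop) (by fun_prop)

lemma lintegral_palmMarginal {n k : ℕ} (τ : Fin n → Fin k)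
    {F : ((Fin n → X) × ℝ) × Measure X → ℝ≥0∞} (hF : Measurable F) (z : Fin k → X)
    (ρ : Measure (Measure X)) [SFinite ρ] :
    ∫⁻ μ, palmMarginal H τ F (z, μ) ∂ρ = ∫⁻ u in Set.Ioi 0, gammaWeight n u *
      ∫⁻ s, ∫⁻ μ, palmIntegrand τ F z u s μ ∂ρ ∂(Measure.pi fun _ : Fin k => H) := by
  have hm : Measurable fun q : Measure X × ℝ => gammaWeight n q.2 *
      ∫⁻ s, palmIntegrand τ F z q.2 s q.1 ∂(Measure.pi fun _ : Fin k => H) :=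
    (measurable_palmMarginal_aux τ hF).comp
      (by fun_prop : Measurable fun q : Measure X × ℝ => ((z, q.1), q.2))
  refine (lintegral_lintegral_swap (f := fun μ u => gammaWeight n u *
    ∫⁻ s, palmIntegrand τ F z u s μ ∂(Measure.pi fun _ : Fin k => H)) hm.aemeasurable).trans ?_
  refine lintegral_congr fun u => ?_
  have hm' : Measurable fun q : Measure X × (Fin k → ℝ) => palmIntegrand τ F z u q.2 q.1 :=
    Measurable.palmIntegrand τ hF (by fun_prop) (by fun_prop) (by fun_prop) (by fun_prop)
  refine (lintegral_const_mul _ hm'.lintegral_prod_right').trans ?_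
  congr 1
  exact lintegral_lintegral_swap (f := fun μ s => palmIntegrand τ F z u s μ) hm'.aemeasurable

lemma measurable_obsIntegrand {n m : ℕ} (x : Fin m → X) (i : Fin n → Fin m)
    {F : ((Fin n → X) × ℝ) × Measure X → ℝ≥0∞} (hF : Measurable F) :
    Measurable fun q : (Fin m → ℝ) × ℝ => gammaWeight n q.2 *
      (expNeg (ENNReal.ofReal q.2 * atomic x q.1 Set.univ) *
        F ((x ∘ i, q.2), atomic x q.1)) := by
  have hmass : Measurable fun s : Fin m → ℝ => atomic x s Set.univ :=
    (Measure.measurable_coe MeasurableSet.univ).comp (by fun_prop)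
  fun_prop

lemma palmIntegrand_split {n k : ℕ} (τ : Fin n → Fin k)
    (F : ((Fin n → X) × ℝ) × Measure X → ℝ≥0∞) (c : Config X) (a : Fin k ↪ Fin c.1)
    (s : Fin k → ℝ) (t : Fin (c.1 - k) → ℝ) (u : ℝ) :
    palmIntegrand τ F (c.2 ∘ a) u s (atomic (remove c a).2 t) =
      (∏ l, ENNReal.ofReal ((Sum.elim s t ∘ (restEquiv a).symm) (a (τ l)))) *
        expNeg (ENNReal.ofReal u * (atomic c.2 (Sum.elim s t ∘ (restEquiv a).symm)) Set.univ) *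
        F ((c.2 ∘ (a ∘ τ), u), atomic c.2 (Sum.elim s t ∘ (restEquiv a).symm)) := by
  rw [prod_mul_expNeg_split, atomic_split]
  rfl

/-- The contribution of the embedding `a` of the observed points. -/
lemma lintegral_embedding_term {n k : ℕ} (τ : Fin n → Fin k)
    {F : ((Fin n → X) × ℝ) × Measure X → ℝ≥0∞} (hF : Measurable F) (c : Config X)
    (a : Fin k ↪ Fin c.1) :
    ∫⁻ s, (∏ l, ENNReal.ofReal (s (a (τ l)))) * (∫⁻ u in Set.Ioi 0, gammaWeight n u *
      (expNeg (ENNReal.ofReal u * atomic c.2 s Set.univ) *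
        F ((c.2 ∘ (a ∘ τ), u), atomic c.2 s))) ∂(Measure.pi fun _ : Fin c.1 => H) =
    ∫⁻ μ, palmMarginal H τ F (c.2 ∘ a, μ) ∂(rmKernel X H (remove c a)) := by
  have hterm : Measurable fun s : Fin c.1 → ℝ =>
      (∏ l, ENNReal.ofReal (s (a (τ l)))) * ∫⁻ u in Set.Ioi 0, gammaWeight n u *
        (expNeg (ENNReal.ofReal u * atomic c.2 s Set.univ) *
          F ((c.2 ∘ (a ∘ τ), u), atomic c.2 s)) :=
    Measurable.mul (by fun_prop) (measurable_obsIntegrand c.2 (a ∘ τ) hF).lintegral_prod_right'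
  have hm : Measurable fun q : ((Fin (c.1 - k) → ℝ) × (Fin k → ℝ)) × ℝ =>
      gammaWeight n q.2 *
        palmIntegrand τ F (c.2 ∘ a) q.2 q.1.2 (atomic (remove c a).2 q.1.1) :=
    Measurable.mul (by fun_prop) (Measurable.palmIntegrand τ hF (by fun_prop) (by fun_prop)
      (by fun_prop) (Measurable.atomic measurable_const (by fun_prop)))
  have hm' : Measurable fun q : (Fin (c.1 - k) → ℝ) × (Fin k → ℝ) =>
      ∫⁻ u in Set.Ioi 0, gammaWeight n u *
        palmIntegrand τ F (c.2 ∘ a) u q.2 (atomic (remove c a).2 q.1) :=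
    hm.lintegral_prod_right'
  have hz : Measurable fun μ => palmMarginal H τ F (c.2 ∘ a, μ) :=
    (measurable_palmMarginal τ hF).comp measurable_prodMk_left
  rw [lintegral_rmKernel _ hz]
  simp only [palmMarginal_eq τ hF]
  -- The marks of the observed points are independent of the others, and the latter are exactly the
  -- marks attached to `remove c a`.
  refine (lintegral_pi_split H (restEquiv a) hterm).trans ?_
  refine Eq.trans ?_ (lintegral_lintegral_swap (μ := Measure.pi fun _ : Fin (c.1 - k) => H)
    (ν := Measure.pi fun _ : Fin k => H) (f := fun t s => ∫⁻ u in Set.Ioi 0,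
    gammaWeight n u * palmIntegrand τ F (c.2 ∘ a) u s (atomic (remove c a).2 t))
    hm'.aemeasurable).symm
  refine lintegral_congr fun s => lintegral_congr fun t => ?_
  refine (lintegral_const_mul _ ((measurable_obsIntegrand c.2 (a ∘ τ) hF).comp
    measurable_prodMk_left)).symm.trans (lintegral_congr fun u => ?_)
  refine Eq.trans ?_ (congrArg (gammaWeight n u * ·) (palmIntegrand_split τ F c a s t u)).symm
  have hcomm : ∀ a b c d : ℝ≥0∞, a * (b * (c * d)) = b * (a * c * d) := fun a b c d => by ring
  exact hcomm _ _ _ _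

/-- As `F` is supported on the pattern τ and the points are distinct, only index choices of the form
`a ∘ τ` contribute. Positivity of the marks excludes a zero normalizer. -/
lemma lintegral_obsKernel_eq_sum {n k : ℕ} (hn : 1 ≤ n) (hpos : ∀ᵐ s ∂H, 0 < s)
    {τ : Fin n → Fin k} (hτ : Function.Surjective τ)
    {F : ((Fin n → X) × ℝ) × Measure X → ℝ≥0∞} (hF : Measurable F)
    (hsupp : ∀ y u μ, y ∉ patternSet X τ → F ((y, u), μ) = 0) {c : Config X}
    (hc : Function.Injective c.2) :
    ∫⁻ μ, ∫⁻ p, F p ∂(obsKernel X n μ) ∂(rmKernel X H c) = ∑ a : Fin k ↪ Fin c.1,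
      ∫⁻ μ, palmMarginal H τ F (c.2 ∘ a, μ) ∂(rmKernel X H (remove c a)) := by
  have hspos : ∀ᵐ s ∂(Measure.pi fun _ : Fin c.1 => H), ∀ j, 0 < s j :=
    ae_all_iff.2 fun j => (Measure.quasiMeasurePreserving_eval (fun _ : Fin c.1 => H) j).ae hpos
  have hterm : ∀ a : Fin k ↪ Fin c.1, Measurable fun s : Fin c.1 → ℝ =>
      (∏ l, ENNReal.ofReal (s (a (τ l)))) * ∫⁻ u in Set.Ioi 0, gammaWeight n u *
        (expNeg (ENNReal.ofReal u * atomic c.2 s Set.univ) *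
          F ((c.2 ∘ (a ∘ τ), u), atomic c.2 s)) := fun a =>
    Measurable.mul (by fun_prop) (measurable_obsIntegrand c.2 (a ∘ τ) hF).lintegral_prod_right'
  rw [lintegral_rmKernel c hF.lintegral_kernel]
  simp only [← lintegral_embedding_term τ hF c]
  rw [← lintegral_finsetSum _ fun a _ => hterm a]
  refine lintegral_congr_ae (hspos.mono fun s hs => ?_)
  beta_reduce
  rw [lintegral_obsKernel_atomic hn c.2 hs hF]
  refine sum_eq_sum_embedding hτ hc _ fun i hi => ?_
  simp [hsupp _ _ _ hi]

variable [StandardBorelSpace X] {P : Measure (Config X)}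

/-- The joint law of the observations and the random measure in terms of the reduced Palm kernel,
on the event that the observations have the pattern `τ` of ties. -/
theorem lintegral_jointLaw {n k : ℕ} (hn : 1 ≤ n) (hpos : ∀ᵐ s ∂H, 0 < s)
    (hsimple : ∀ᵐ c ∂P, Function.Injective c.2) [SigmaFinite (momentMeasure P k)]
    {Q : Kernel (Fin k → X) (Config X)} (hQ : IsReducedPalmKernel P k Q)
    {τ : Fin n → Fin k} (hτ : Function.Surjective τ)
    {F : ((Fin n → X) × ℝ) × Measure X → ℝ≥0∞} (hF : Measurable F)
    (hsupp : ∀ y u μ, y ∉ patternSet X τ → F ((y, u), μ) = 0) :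
    ∫⁻ p, F p ∂(jointLaw P H n) = ∫⁻ z in injSet X k, (∫⁻ u in Set.Ioi 0, gammaWeight n u *
      ∫⁻ s, ∫⁻ μ, palmIntegrand τ F z u s μ ∂(rmLaw (Q z) H) ∂(Measure.pi fun _ : Fin k => H))
      ∂(momentMeasure P k) := by
  have hG := measurable_palmMarginal (H := H) τ hF
  have hGc : Measurable fun p : (Fin k → X) × Config X =>
      ∫⁻ μ, palmMarginal H τ F (p.1, μ) ∂(rmKernel X H p.2) :=
    measurable_lintegral_rmKernel measurable_snd
      (g := fun q : ((Fin k → X) × Config X) × Measure X => palmMarginal H τ F (q.1.1, q.2))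
      (hG.comp (by fun_prop))
  rw [jointLaw_eq_bind, Measure.lintegral_bind (obsKernel X n).aemeasurable hF.aemeasurable,
    lintegral_rmLaw P hF.lintegral_kernel]
  refine (lintegral_congr_ae (hsimple.mono fun c hc =>
    lintegral_obsKernel_eq_sum hn hpos hτ hF hsupp hc)).trans ?_
  -- The sum over embeddings averaged over Φ is an integral against the reduced Campbell measure, to
  -- which the Palm disintegration applies.
  refine (lintegral_reducedCampbell P k hGc).symm.trans ?_
  refine (lintegral_reducedCampbell_rmKernel hsimple hQ hG).trans ?_
  have := hQ.isMarkovKernel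
  exact lintegral_congr fun z => lintegral_palmMarginal τ hF z _

end KeyFormula

/-! ### Tilted laws of the observed jumps -/

section Jumps

/-- The truncations in `jumpWeight` are harmless for positive arguments, and `H` charges only
positive marks. -/
lemma jumpWeight_eq {u s : ℝ} (hu : 0 < u) (hs : 0 < s) (m : ℕ) :
    jumpWeight u m s = ENNReal.ofReal (Real.exp (-u * s) * s ^ m) := by
  rw [jumpWeight, ← ENNReal.ofReal_mul hu.le, expNeg_ofReal (by positivity),
    ← ENNReal.ofReal_pow hs.le, ← ENNReal.ofReal_mul (by positivity), neg_mul]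

lemma lintegral_jumpWeight {H : Measure ℝ} (hpos : ∀ᵐ s ∂H, 0 < s) {u : ℝ} (hu : 0 < u) (m : ℕ) :
    ∫⁻ s, jumpWeight u m s ∂H = kappa H u m :=
  lintegral_congr_ae (hpos.mono fun _ hs => jumpWeight_eq hu hs m)

lemma lawWithDensityPropTo_jump {H : Measure ℝ} {h : ℝ → ℝ≥0∞} (hh : Measurable h)
    (hH : H = (volume.restrict (Set.Ioi 0)).withDensity h) (hpos : ∀ᵐ s ∂H, 0 < s) {u : ℝ}
    (hu : 0 < u) (m : ℕ) :
    (lawWithDensityPropTo fun s => ENNReal.ofReal (Real.exp (-u * s) * s ^ m) * h s) =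
      (kappa H u m)⁻¹ • H.withDensity (jumpWeight u m) := by
  have h1 : (volume.restrict (Set.Ioi 0)).withDensity
      (fun s => ENNReal.ofReal (Real.exp (-u * s) * s ^ m) * h s) =
        H.withDensity (jumpWeight u m) := by
    rw [withDensity_congr_ae (hpos.mono fun _ hs => jumpWeight_eq hu hs m)]
    conv_rhs => rw [hH]
    rw [← withDensity_mul _ hh (by fun_prop)]
    congr 1
    ext s
    exact mul_comm _ _
  rw [lawWithDensityPropTo, normalized, h1, withDensity_apply _ MeasurableSet.univ,
    Measure.restrict_univ, lintegral_jumpWeight hpos hu]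

variable {H : Measure ℝ} [IsProbabilityMeasure H]

/-- The exponential series gives (us)^m / m! ≤ e^{us}, hence e^{-us} s^m ≤ m! / u^m, a constant
bound against the probability measure `H`. -/
lemma kappa_ne_top (hpos : ∀ᵐ s ∂H, 0 < s) {u : ℝ} (hu : 0 < u) (m : ℕ) : kappa H u m ≠ ∞ := by
  have hb : kappa H u m ≤ ∫⁻ _, ENNReal.ofReal (m.factorial / u ^ m) ∂H := by
    refine lintegral_mono_ae (hpos.mono fun s hs => ENNReal.ofReal_le_ofReal ?_)
    have h1 := Real.pow_div_factorial_le_exp (u * s) (by positivity) m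
    have h2 : Real.exp (-u * s) * Real.exp (u * s) = 1 := by
      rw [← Real.exp_add]
      simp
    rw [div_le_iff₀ (by positivity), mul_pow] at h1
    rw [le_div_iff₀ (by positivity)]
    calc Real.exp (-u * s) * s ^ m * u ^ m = Real.exp (-u * s) * (u ^ m * s ^ m) := by ring
      _ ≤ Real.exp (-u * s) * (Real.exp (u * s) * m.factorial) := by gcongr
      _ = m.factorial := by rw [← mul_assoc, h2, one_mul]
  refine (hb.trans_lt ?_).ne
  simp

lemma kappa_ne_zero (hpos : ∀ᵐ s ∂H, 0 < s) (u : ℝ) (m : ℕ) : kappa H u m ≠ 0 := by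
  intro h
  rw [kappa, lintegral_eq_zero_iff (by fun_prop)] at h
  have : ∀ᵐ _ ∂H, False := by
    filter_upwards [hpos, h] with s hs h0
    exact (ENNReal.ofReal_pos.2 (by positivity : 0 < Real.exp (-u * s) * s ^ m)).ne' h0
  exact (IsProbabilityMeasure.ne_zero H) (by simpa using this)

lemma isProbabilityMeasure_jump (hpos : ∀ᵐ s ∂H, 0 < s) {u : ℝ} (hu : 0 < u) (m : ℕ) :
    IsProbabilityMeasure ((kappa H u m)⁻¹ • H.withDensity (jumpWeight u m)) := by
  refine ⟨?_⟩
  rw [Measure.smul_apply, withDensity_apply _ MeasurableSet.univ, Measure.restrict_univ,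
    lintegral_jumpWeight hpos hu, smul_eq_mul,
    ENNReal.inv_mul_cancel (kappa_ne_zero hpos u m) (kappa_ne_top hpos hu m)]

/-- A product of laws with densities with respect to `H`. -/
lemma pi_smul_withDensity {ι : Type*} [Fintype ι] {c : ι → ℝ≥0∞} {d : ι → ℝ → ℝ≥0∞}
    (hd : ∀ j, Measurable (d j)) [∀ j, IsProbabilityMeasure (c j • H.withDensity (d j))] :
    Measure.pi (fun j => c j • H.withDensity (d j)) =
      (∏ j, c j) • (Measure.pi fun _ : ι => H).withDensity fun s => ∏ j, d j (s j) := by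
  refine Measure.pi_eq fun A hA => ?_
  have hbox : MeasurableSet (Set.univ.pi A) := MeasurableSet.univ_pi hA
  rw [Measure.smul_apply, withDensity_apply _ hbox, ← lintegral_indicator hbox, smul_eq_mul]
  have h1 : ∀ s : ι → ℝ, (Set.univ.pi A).indicator (fun s => ∏ j, d j (s j)) s =
      ∏ j, (A j).indicator (d j) (s j) := fun s => by
    by_cases hs : ∀ j, s j ∈ A j
    · rw [Set.indicator_of_mem (by simpa using hs)]
      exact Finset.prod_congr rfl fun j _ => (Set.indicator_of_mem (hs j) _).symm
    · rw [Set.indicator_of_notMem (by simpa using hs)]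
      push Not at hs
      obtain ⟨j, hj⟩ := hs
      exact (Finset.prod_eq_zero (Finset.mem_univ j) (Set.indicator_of_notMem hj _)).symm
  rw [lintegral_congr h1, lintegral_pi_prod H fun j => (hd j).indicator (hA j),
    ← Finset.prod_mul_distrib]
  refine Finset.prod_congr rfl fun j _ => ?_
  rw [Measure.smul_apply, withDensity_apply _ (hA j), lintegral_indicator (hA j), smul_eq_mul]

end Jumps

/-! ### Exponential tilting by the total mass -/

section Tilt

variable {X : Type*} [MeasurableSpace X]

lemma measurable_expNeg_mass (u : ℝ) :
    Measurable fun μ : Measure X => expNeg (ENNReal.ofReal u * μ Set.univ) :=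
  measurable_expNeg.comp (measurable_const.mul (Measure.measurable_coe MeasurableSet.univ))

lemma laplace_const (ρ : Measure (Measure X)) (u : ℝ) :
    laplace ρ (fun _ => u.toNNReal) = ∫⁻ μ, expNeg (ENNReal.ofReal u * μ Set.univ) ∂ρ := by
  rw [laplace_eq]
  simp only [lintegral_const]
  rfl

/-- The law with density proportional to `e^{-u μ(X)}` with respect to `ρ`. -/
def tilt (ρ : Measure (Measure X)) (u : ℝ) : Measure (Measure X) :=
  (laplace ρ fun _ => u.toNNReal)⁻¹ •
    ρ.withDensity fun μ => expNeg (ENNReal.ofReal u * μ Set.univ)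

variable {ρ : Measure (Measure X)}

lemma lintegral_tilt (u : ℝ) {g : Measure X → ℝ≥0∞} (hg : Measurable g) :
    ∫⁻ μ, g μ ∂(tilt ρ u) = (laplace ρ fun _ => u.toNNReal)⁻¹ *
      ∫⁻ μ, expNeg (ENNReal.ofReal u * μ Set.univ) * g μ ∂ρ := by
  rw [tilt, lintegral_smul_measure, smul_eq_mul,
    lintegral_withDensity_eq_lintegral_mul _ (measurable_expNeg_mass u) hg]
  rfl

/-- The tilting factor merges with the exponential of the integral, e^{-u μ(X)} e^{-∫ f dμ} = e^{-∫
(f + u) dμ}. Thus `tilt` realizes the Laplace functional prescribed for the remainder. -/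
lemma laplace_tilt (u : ℝ) {f : X → ℝ≥0} (hf : Measurable f) :
    laplace (tilt ρ u) f =
      laplace ρ (fun z => f z + u.toNNReal) / laplace ρ fun _ => u.toNNReal := by
  have hm : Measurable fun μ : Measure X => expNeg (∫⁻ z, f z ∂μ) :=
    measurable_expNeg.comp (Measure.measurable_lintegral hf.coe_nnreal_ennreal)
  rw [laplace_eq, lintegral_tilt u hm, ENNReal.div_eq_inv_mul]
  congr 1
  rw [laplace_eq]
  refine lintegral_congr fun μ => ?_
  rw [← expNeg_add, add_comm]
  simp only [ENNReal.coe_add]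
  rw [lintegral_add_left hf.coe_nnreal_ennreal, lintegral_const]
  rfl

lemma ae_tilt_isFiniteMeasure (hfin : ∀ᵐ μ ∂ρ, IsFiniteMeasure μ) (u : ℝ) :
    ∀ᵐ μ ∂(tilt ρ u), IsFiniteMeasure μ := by
  refine Measure.AbsolutelyContinuous.ae_le ?_ hfin
  exact (withDensity_absolutelyContinuous _ _).smul_left _

variable [IsProbabilityMeasure ρ]

lemma laplace_const_ne_top (u : ℝ) : laplace ρ (fun _ => u.toNNReal) ≠ ∞ := by
  refine ((lintegral_mono fun μ => expNeg_le_one _).trans_lt ?_).ne (b := ∞)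
  simp

/-- The total mass is almost surely finite, so e^{-u μ(X)} is almost surely positive. -/
lemma laplace_const_ne_zero (hfin : ∀ᵐ μ ∂ρ, IsFiniteMeasure μ) (u : ℝ) :
    laplace ρ (fun _ => u.toNNReal) ≠ 0 := by
  intro h
  rw [laplace_const, lintegral_eq_zero_iff (measurable_expNeg_mass u)] at h
  have : ∀ᵐ _ ∂ρ, False := by
    filter_upwards [hfin, h] with μ hμ h0
    exact expNeg_ne_zero (ENNReal.mul_ne_top ENNReal.ofReal_ne_top (measure_ne_top μ _)) h0
  exact (IsProbabilityMeasure.ne_zero ρ) (by simpa using this)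

lemma isProbabilityMeasure_tilt (hfin : ∀ᵐ μ ∂ρ, IsFiniteMeasure μ) (u : ℝ) :
    IsProbabilityMeasure (tilt ρ u) := by
  refine ⟨?_⟩
  have h := lintegral_tilt (ρ := ρ) u measurable_one
  simp only [Pi.one_apply, mul_one, lintegral_one] at h
  rw [h, ← laplace_const,
    ENNReal.inv_mul_cancel (laplace_const_ne_zero hfin u) (laplace_const_ne_top u)]

end Tilt

/-! ### The posterior law as a normalized weight -/

section Posterior

variable {X : Type*} [MeasurableSpace X] {H : Measure ℝ} [IsProbabilityMeasure H]

/-- The unnormalized posterior expectation of `g`, given distinct values `z` with multiplicities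
from `τ` and auxiliary variable `u`, where `ρ` is the law of the random measure without the
points `z`. -/
def palmMass (H : Measure ℝ) {n k : ℕ} (τ : Fin n → Fin k) (ρ : Measure (Measure X))
    (z : Fin k → X) (u : ℝ) (g : Measure X → ℝ≥0∞) : ℝ≥0∞ :=
  ∫⁻ s, ∫⁻ μ, (∏ j, jumpWeight u (count τ j) (s j)) *
    (expNeg (ENNReal.ofReal u * μ Set.univ) * g (atomic z s + μ)) ∂ρ
    ∂(Measure.pi fun _ : Fin k => H)

/-- The weight is a product of functions of the independent jumps and of the remainder. This
normalizer is also, up to the gamma weight, the density in `u` of the second claim. -/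
lemma palmMass_one {n k : ℕ} (hpos : ∀ᵐ s ∂H, 0 < s) (τ : Fin n → Fin k)
    (ρ : Measure (Measure X)) (z : Fin k → X) {u : ℝ} (hu : 0 < u) :
    palmMass H τ ρ z u 1 = (∏ j, kappa H u (count τ j)) * laplace ρ fun _ => u.toNNReal := by
  have hm : Measurable fun s : Fin k → ℝ => ∏ j, jumpWeight u (count τ j) (s j) := by fun_prop
  simp only [palmMass, Pi.one_apply, mul_one]
  rw [laplace_const, lintegral_congr fun s => lintegral_const_mul _ (measurable_expNeg_mass u),
    lintegral_mul_const _ hm, lintegral_pi_prod H (fun j => by fun_prop)]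
  simp only [lintegral_jumpWeight hpos hu]

lemma palmMass_one_ne_zero {n k : ℕ} (hpos : ∀ᵐ s ∂H, 0 < s) (τ : Fin n → Fin k)
    {ρ : Measure (Measure X)} [IsProbabilityMeasure ρ] (hfin : ∀ᵐ μ ∂ρ, IsFiniteMeasure μ)
    (z : Fin k → X) {u : ℝ} (hu : 0 < u) : palmMass H τ ρ z u 1 ≠ 0 := by
  rw [palmMass_one hpos τ ρ z hu]
  exact mul_ne_zero (Finset.prod_ne_zero_iff.2 fun j _ => kappa_ne_zero hpos u _)
    (laplace_const_ne_zero hfin u)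

lemma palmMass_one_ne_top {n k : ℕ} (hpos : ∀ᵐ s ∂H, 0 < s) (τ : Fin n → Fin k)
    (ρ : Measure (Measure X)) [IsProbabilityMeasure ρ] (z : Fin k → X) {u : ℝ} (hu : 0 < u) :
    palmMass H τ ρ z u 1 ≠ ∞ := by
  rw [palmMass_one hpos τ ρ z hu]
  exact ENNReal.mul_ne_top (ENNReal.prod_ne_top fun j _ => kappa_ne_top hpos hu _)
    (laplace_const_ne_top u)

/-- The law of `∑ j, S_j δ_{z_j} + μ'` with independent jumps and rest. -/
def posteriorLaw (h : ℝ → ℝ≥0∞) {n k : ℕ} (τ : Fin n → Fin k) (ρ : Measure (Measure X))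
    (z : Fin k → X) (u : ℝ) : Measure (Measure X) :=
  ((Measure.pi fun j : Fin k => lawWithDensityPropTo fun s =>
    ENNReal.ofReal (Real.exp (-u * s) * s ^ count τ j) * h s).prod (tilt ρ u)).map
      fun sμ => atomic z sμ.1 + sμ.2

lemma measurable_atomic_add {k : ℕ} (z : Fin k → X) :
    Measurable fun sμ : (Fin k → ℝ) × Measure X => atomic z sμ.1 + sμ.2 :=
  measurable_measure_add (Measurable.atomic measurable_const measurable_fst) measurable_snd

variable {h : ℝ → ℝ≥0∞}

lemma isProbabilityMeasure_posteriorLaw (hh : Measurable h)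
    (hH : H = (volume.restrict (Set.Ioi 0)).withDensity h) (hpos : ∀ᵐ s ∂H, 0 < s) {n k : ℕ}
    (τ : Fin n → Fin k) {ρ : Measure (Measure X)} [IsProbabilityMeasure ρ]
    (hfin : ∀ᵐ μ ∂ρ, IsFiniteMeasure μ) (z : Fin k → X) {u : ℝ} (hu : 0 < u) :
    IsProbabilityMeasure (posteriorLaw h τ ρ z u) := by
  have := isProbabilityMeasure_tilt hfin u
  have := fun j => isProbabilityMeasure_jump hpos hu (count τ j)
  simp only [posteriorLaw, lawWithDensityPropTo_jump hh hH hpos hu]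
  exact Measure.isProbabilityMeasure_map (measurable_atomic_add z).aemeasurable

lemma ae_posteriorLaw_isFiniteMeasure (hh : Measurable h)
    (hH : H = (volume.restrict (Set.Ioi 0)).withDensity h) (hpos : ∀ᵐ s ∂H, 0 < s) {n k : ℕ}
    (τ : Fin n → Fin k) {ρ : Measure (Measure X)} [IsProbabilityMeasure ρ]
    (hfin : ∀ᵐ μ ∂ρ, IsFiniteMeasure μ) (z : Fin k → X) {u : ℝ} (hu : 0 < u) :
    ∀ᵐ μ ∂(posteriorLaw h τ ρ z u), IsFiniteMeasure μ := by
  have := isProbabilityMeasure_tilt hfin u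
  have := fun j => isProbabilityMeasure_jump hpos hu (count τ j)
  simp only [posteriorLaw, lawWithDensityPropTo_jump hh hH hpos hu]
  rw [ae_map_iff (measurable_atomic_add z).aemeasurable measurableSet_isFiniteMeasure]
  exact (Measure.quasiMeasurePreserving_snd.ae (ae_tilt_isFiniteMeasure hfin u)).mono
    fun sμ hμ => inferInstance

/-- Normalizing each factor separately equals normalizing the whole weight, because the total is the
product of the factors' totals, all of them positive and finite. -/
lemma posteriorLaw_apply (hh : Measurable h)
    (hH : H = (volume.restrict (Set.Ioi 0)).withDensity h) (hpos : ∀ᵐ s ∂H, 0 < s) {n k : ℕ}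
    (τ : Fin n → Fin k) {ρ : Measure (Measure X)} [IsProbabilityMeasure ρ]
    (hfin : ∀ᵐ μ ∂ρ, IsFiniteMeasure μ) (z : Fin k → X) {u : ℝ} (hu : 0 < u)
    {L : Set (Measure X)} (hL : MeasurableSet L) :
    posteriorLaw h τ ρ z u L =
      (palmMass H τ ρ z u 1)⁻¹ * palmMass H τ ρ z u (L.indicator 1) := by
  have := isProbabilityMeasure_tilt hfin u
  have := fun j => isProbabilityMeasure_jump hpos hu (count τ j)
  have hind : Measurable (L.indicator (1 : Measure X → ℝ≥0∞)) := measurable_one.indicator hL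
  have hm : Measurable fun sμ : (Fin k → ℝ) × Measure X =>
      L.indicator (1 : Measure X → ℝ≥0∞) (atomic z sμ.1 + sμ.2) :=
    hind.comp (measurable_atomic_add z)
  have hs : ∀ s : Fin k → ℝ, Measurable fun μ : Measure X =>
      L.indicator (1 : Measure X → ℝ≥0∞) (atomic z s + μ) := fun s =>
    hind.comp (measurable_measure_add measurable_const measurable_id)
  have hm' : Measurable fun sμ : (Fin k → ℝ) × Measure X =>
      expNeg (ENNReal.ofReal u * sμ.2 Set.univ) *
        L.indicator (1 : Measure X → ℝ≥0∞) (atomic z sμ.1 + sμ.2) :=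
    ((measurable_expNeg_mass u).comp measurable_snd).mul hm
  have hm1 : Measurable fun s : Fin k → ℝ => ∫⁻ μ, expNeg (ENNReal.ofReal u * μ Set.univ) *
      L.indicator (1 : Measure X → ℝ≥0∞) (atomic z s + μ) ∂ρ := hm'.lintegral_prod_right'
  have hprod : Measurable fun s : Fin k → ℝ => ∏ j, jumpWeight u (count τ j) (s j) := by fun_prop
  rw [← lintegral_indicator_one hL, posteriorLaw, lintegral_map hind (measurable_atomic_add z)]
  simp only [lawWithDensityPropTo_jump hh hH hpos hu]
  rw [pi_smul_withDensity fun j => by fun_prop]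
  rw [Measure.prod_smul_left, lintegral_smul_measure, lintegral_prod _ hm.aemeasurable,
    lintegral_congr fun s => lintegral_tilt u (hs s), lintegral_const_mul _ hm1,
    lintegral_withDensity_eq_lintegral_mul _ hprod hm1, palmMass_one hpos τ ρ z hu,
    ENNReal.mul_inv (Or.inr (laplace_const_ne_top u)) (Or.inr (laplace_const_ne_zero hfin u)),
    ENNReal.prod_inv_distrib, smul_eq_mul, ← mul_assoc]
  · congr 1
    refine lintegral_congr fun s => ?_
    exact (lintegral_const_mul _ ((measurable_expNeg_mass u).mul (hs s))).symm
  · exact fun i _ j _ _ => Or.inl (kappa_ne_zero hpos u _)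

end Posterior

/-! ### Conditional kernels and the joint law on products -/

section JointLaw

section CondKernel

/-- A regular conditional distribution exists for the image, in the second variable, of a measure
on a product with a standard Borel space. -/
lemma exists_isCondKernel_of_map {α Ω Ω' : Type*} [MeasurableSpace α] [MeasurableSpace Ω]
    [MeasurableSpace Ω'] [StandardBorelSpace Ω] [Nonempty Ω] (ρ : Measure (α × Ω))
    [IsFiniteMeasure ρ] {f : Ω → Ω'} (hf : Measurable f) :
    ∃ K : Kernel α Ω', IsMarkovKernel K ∧ (ρ.map (Prod.map id f)).IsCondKernel K := by
  refine ⟨ρ.condKernel.map f, Kernel.IsMarkovKernel.map _ hf, ⟨?_⟩⟩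
  have hfst : (ρ.map (Prod.map id f)).fst = ρ.fst := by
    rw [Measure.fst, Measure.fst, Measure.map_map measurable_fst (by fun_prop)]
    rfl
  rw [hfst, Measure.compProd_map hf, ρ.disintegrate]

/-- Conditional probabilities of an event are determined almost everywhere on `D`. -/
lemma ae_condKernel_eq {α Ω : Type*} [MeasurableSpace α] [MeasurableSpace Ω]
    {ρ : Measure (α × Ω)} [IsFiniteMeasure ρ] {K : Kernel α Ω} [IsMarkovKernel K]
    (hK : ρ.IsCondKernel K) {D : Set α} (hD : MeasurableSet D) {L : Set Ω} (hL : MeasurableSet L)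
    {b : α → ℝ≥0∞} (hb : Measurable b)
    (h : ∀ E, MeasurableSet E → E ⊆ D → ρ (E ×ˢ L) = ∫⁻ a in E, b a ∂ρ.fst) :
    ∀ᵐ a ∂ρ.fst, a ∈ D → K a L = b a := by
  rw [← ae_restrict_iff' hD]
  refine ae_eq_of_forall_setLIntegral_eq_of_sigmaFinite (K.measurable_coe hL) hb fun s hs _ => ?_
  rw [Measure.restrict_restrict hs, ← h _ (hs.inter hD) Set.inter_subset_right]
  nth_rw 2 [← hK.disintegrate]
  rw [Measure.compProd_apply_prod (hs.inter hD) hL]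

end CondKernel

/-- A representative index for each label recovers the distinct values as `y ∘ σ`, a measurable
function of `y`. Membership then becomes a measurable condition. -/
lemma patternSet_eq_of_rightInverse {X : Type*} {n k : ℕ} {τ : Fin n → Fin k} {σ : Fin k → Fin n}
    (hσ : ∀ j, τ (σ j) = j) :
    patternSet X τ = {y | y ∘ σ ∈ injSet X k} ∩ {y | y = (y ∘ σ) ∘ τ} := by
  ext y
  constructor
  · rintro ⟨z, hz, rfl⟩
    have : (z ∘ τ) ∘ σ = z := funext fun j => congrArg z (hσ j)
    exact ⟨by rw [Set.mem_ofPred_eq, this]; exact hz, by rw [Set.mem_ofPred_eq, this]⟩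
  · exact fun ⟨h1, h2⟩ => ⟨y ∘ σ, h1, h2⟩

variable {X : Type*} [MeasurableSpace X] {H : Measure ℝ} [IsProbabilityMeasure H]

section Marked

/-- Finite configurations of points with real marks. -/
abbrev MarkedConfig (X : Type*) := Σ m : ℕ, (Fin m → X) × (Fin m → ℝ)

/-- The atomic measure of a marked configuration. -/
def MarkedConfig.measure (w : MarkedConfig X) : Measure X := atomic w.2.1 w.2.2

lemma measurable_markedConfig_measure :
    Measurable (MarkedConfig.measure : MarkedConfig X → Measure X) :=
  measurable_of_sigma fun _ => measurable_atomic

lemma measurable_markedConfig_mk (c : Config X) :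
    Measurable fun s : Fin c.1 → ℝ => (⟨c.1, (c.2, s)⟩ : MarkedConfig X) :=
  (measurable_sigma_mk (β := fun m : ℕ => (Fin m → X) × (Fin m → ℝ)) c.1).comp
    measurable_prodMk_left

/-- Attaching i.i.d. marks to a configuration. -/
def markKernel (X : Type*) [MeasurableSpace X] (H : Measure ℝ) [IsProbabilityMeasure H] :
    Kernel (Config X) (MarkedConfig X) where
  toFun c := (Measure.pi fun _ : Fin c.1 => H).map fun s => ⟨c.1, (c.2, s)⟩
  measurable' := by
    refine measurable_of_sigma fun m => Measure.measurable_of_measurable_coe _ fun S hS => ?_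
    have hmk : Measurable fun p : (Fin m → X) × (Fin m → ℝ) => (⟨m, p⟩ : MarkedConfig X) :=
      measurable_sigma_mk (β := fun m : ℕ => (Fin m → X) × (Fin m → ℝ)) m
    have h : ∀ x : Fin m → X, ((Measure.pi fun _ : Fin m => H).map
        fun s => (⟨m, (x, s)⟩ : MarkedConfig X)) S = (Measure.pi fun _ : Fin m => H)
          (Prod.mk x ⁻¹' ((fun p => (⟨m, p⟩ : MarkedConfig X)) ⁻¹' S)) := fun x =>
      Measure.map_apply (hmk.comp measurable_prodMk_left) hS
    simp only [h]
    exact measurable_measure_prodMk_left (hmk hS)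

instance : IsMarkovKernel (markKernel X H) :=
  ⟨fun c => Measure.isProbabilityMeasure_map (measurable_markedConfig_mk c).aemeasurable⟩

lemma markKernel_map : (markKernel X H).map MarkedConfig.measure = rmKernel X H := by
  ext c : 1
  rw [Kernel.map_apply _ measurable_markedConfig_measure]
  exact Measure.map_map measurable_markedConfig_measure (measurable_markedConfig_mk c)

/-- The random measure is lifted to its marked configuration, which lives in a standard Borel space.
The conditional law exists there and is pushed forward to measures. -/
lemma exists_jointLaw_isCondKernel [StandardBorelSpace X] (P : Measure (Config X))
    [IsProbabilityMeasure P] (n : ℕ) :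
    ∃ K : Kernel ((Fin n → X) × ℝ) (Measure X), IsMarkovKernel K ∧
      (jointLaw P H n).IsCondKernel K := by
  have : Nonempty (MarkedConfig X) := ⟨⟨0, (Fin.elim0, Fin.elim0)⟩⟩
  let κ : Kernel (Measure X) ((Fin n → X) × ℝ) := sampleKernel X n ×ₖ gammaKernel X n
  let κ' : Kernel (MarkedConfig X) (((Fin n → X) × ℝ) × MarkedConfig X) :=
    κ.comap MarkedConfig.measure measurable_markedConfig_measure ×ₖ Kernel.id
  let ρ : Measure (((Fin n → X) × ℝ) × MarkedConfig X) := (P.bind (markKernel X H)).bind κ'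
  have hmap : Measurable (Prod.map id MarkedConfig.measure :
      ((Fin n → X) × ℝ) × MarkedConfig X → ((Fin n → X) × ℝ) × Measure X) :=
    measurable_id.prodMap measurable_markedConfig_measure
  have hκ : ∀ w, (κ' w).map (Prod.map id MarkedConfig.measure) = obsKernel X n w.measure :=
    fun w => by
      rw [Kernel.prod_apply, Kernel.comap_apply, Kernel.id_apply, obsKernel,
        Kernel.prod_apply _ Kernel.id, Kernel.id_apply, ← Measure.map_prod_map _ _ measurable_id measurable_markedConfig_measure,
        Measure.map_id, Measure.map_dirac' measurable_markedConfig_measure]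
  have hJ : ρ.map (Prod.map id MarkedConfig.measure) = jointLaw P H n := by
    have hrm : rmLaw P H = (P.bind (markKernel X H)).map MarkedConfig.measure := by
      rw [rmLaw_eq_bind, ← markKernel_map, Measure.map_comp _ _ measurable_markedConfig_measure]
    rw [jointLaw_eq_bind, hrm]
    ext S hS
    rw [Measure.map_apply hmap hS, Measure.bind_apply (hmap hS) κ'.aemeasurable,
      Measure.bind_apply hS (obsKernel X n).aemeasurable,
      lintegral_map ((obsKernel X n).measurable_coe hS) measurable_markedConfig_measure]
    refine lintegral_congr fun w => ?_
    rw [← hκ, Measure.map_apply hmap hS]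
  rw [← hJ]
  exact exists_isCondKernel_of_map ρ measurable_markedConfig_measure

end Marked

section Formula

lemma measurable_comp_index {n k : ℕ} (σ : Fin k → Fin n) :
    Measurable fun y : Fin n → X => y ∘ σ :=
  measurable_pi_lambda _ fun j => measurable_pi_apply (σ j)

lemma measurable_expectation_rmLaw {k : ℕ} {Q : Kernel (Fin k → X) (Config X)} [IsMarkovKernel Q]
    {β : Type*} [MeasurableSpace β] {z : β → Fin k → X} (hz : Measurable z)
    {g : β × Measure X → ℝ≥0∞} (hg : Measurable g) :
    Measurable fun b => ∫⁻ μ, g (b, μ) ∂(rmLaw (Q (z b)) H) := by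
  have h : ∀ b, rmLaw (Q (z b)) H = ((rmKernel X H ∘ₖ Q).comap z hz) b := fun b => by
    rw [Kernel.comap_apply, Kernel.comp_apply]
    rfl
  simp only [h]
  exact hg.lintegral_kernel_prod_right'

lemma measurable_palmMass {n k : ℕ} (τ : Fin n → Fin k) {Q : Kernel (Fin k → X) (Config X)}
    [IsMarkovKernel Q] {g : Measure X → ℝ≥0∞} (hg : Measurable g) :
    Measurable fun q : (Fin k → X) × ℝ => palmMass H τ (rmLaw (Q q.1) H) q.1 q.2 g := by
  have h1 : Measurable fun q : (((Fin k → X) × ℝ) × (Fin k → ℝ)) × Measure X =>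
      g (atomic q.1.1.1 q.1.2 + q.2) :=
    hg.comp (measurable_measure_add (by fun_prop) measurable_snd)
  have h2 : Measurable fun q : (((Fin k → X) × ℝ) × (Fin k → ℝ)) × Measure X =>
      expNeg (ENNReal.ofReal q.1.1.2 * q.2 Set.univ) :=
    measurable_expNeg.comp (Measurable.mul (by fun_prop)
      ((Measure.measurable_coe MeasurableSet.univ).comp measurable_snd))
  have h3 : Measurable fun q : (((Fin k → X) × ℝ) × (Fin k → ℝ)) × Measure X =>
      (∏ j, jumpWeight q.1.1.2 (count τ j) (q.1.2 j)) *
        (expNeg (ENNReal.ofReal q.1.1.2 * q.2 Set.univ) * g (atomic q.1.1.1 q.1.2 + q.2)) :=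
    Measurable.mul (by fun_prop) (h2.mul h1)
  have h4 : Measurable fun q : ((Fin k → X) × ℝ) × (Fin k → ℝ) => ∫⁻ μ,
      (∏ j, jumpWeight q.1.2 (count τ j) (q.2 j)) *
        (expNeg (ENNReal.ofReal q.1.2 * μ Set.univ) * g (atomic q.1.1 q.2 + μ))
        ∂(rmLaw (Q q.1.1) H) :=
    measurable_expectation_rmLaw (by fun_prop : Measurable
      fun q : ((Fin k → X) × ℝ) × (Fin k → ℝ) => q.1.1) h3
  exact h4.lintegral_prod_right'

variable [StandardBorelSpace X]

lemma measurableSet_patternSet {n k : ℕ} {τ : Fin n → Fin k} (hτ : Function.Surjective τ) :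
    MeasurableSet (patternSet X τ) := by
  rw [patternSet_eq_of_rightInverse (Function.surjInv_eq hτ)]
  refine (measurable_comp_index _ (measurableSet_injSet k)).inter ?_
  exact measurableSet_eq_fun measurable_id
    ((measurable_comp_index τ).comp (measurable_comp_index _))

variable {P : Measure (Config X)}

/-- The joint law on products, on the event that the observations have the pattern `τ`. -/
lemma lintegral_jointLaw_mul {n k : ℕ} (hn : 1 ≤ n) (hpos : ∀ᵐ s ∂H, 0 < s)
    (hsimple : ∀ᵐ c ∂P, Function.Injective c.2) [SigmaFinite (momentMeasure P k)]
    {Q : Kernel (Fin k → X) (Config X)} (hQ : IsReducedPalmKernel P k Q)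
    {τ : Fin n → Fin k} (hτ : Function.Surjective τ) {f : (Fin n → X) × ℝ → ℝ≥0∞}
    (hf : Measurable f) (hsupp : ∀ y u, y ∉ patternSet X τ → f (y, u) = 0)
    {g : Measure X → ℝ≥0∞} (hg : Measurable g) :
    ∫⁻ p, f p.1 * g p.2 ∂(jointLaw P H n) = ∫⁻ z in injSet X k, (∫⁻ u in Set.Ioi 0,
      gammaWeight n u * (f (z ∘ τ, u) * palmMass H τ (rmLaw (Q z) H) z u g))
      ∂(momentMeasure P k) := by
  have := hQ.isMarkovKernel
  rw [lintegral_jointLaw hn hpos hsimple hQ hτ (F := fun p => f p.1 * g p.2) (by fun_prop)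
    fun y u μ hy => by simp [hsupp y u hy]]
  refine lintegral_congr fun z => lintegral_congr fun u => congrArg (gammaWeight n u * ·) ?_
  have hm : Measurable fun q : (Fin k → ℝ) × Measure X =>
      (∏ j, jumpWeight u (count τ j) (q.1 j)) *
        (expNeg (ENNReal.ofReal u * q.2 Set.univ) * g (atomic z q.1 + q.2)) :=
    Measurable.mul (by fun_prop) (((measurable_expNeg_mass u).comp measurable_snd).mul
      (hg.comp (measurable_atomic_add z)))
  rw [palmMass, ← lintegral_const_mul _ hm.lintegral_prod_right']
  refine lintegral_congr fun s => ?_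
  have hm' : Measurable fun μ : Measure X => (∏ j, jumpWeight u (count τ j) (s j)) *
      (expNeg (ENNReal.ofReal u * μ Set.univ) * g (atomic z s + μ)) :=
    Measurable.mul measurable_const ((measurable_expNeg_mass u).mul
      (hg.comp (measurable_measure_add measurable_const measurable_id)))
  refine Eq.trans ?_ (lintegral_const_mul _ hm')
  refine lintegral_congr fun μ => ?_
  rw [palmIntegrand]
  ring

end Formula

end JointLaw

/-! ### Identification of the two conditional laws -/

section ConditionalLaws

lemma measurable_palmMass_comp {X : Type*} [MeasurableSpace X] (H : Measure ℝ)
    [IsProbabilityMeasure H] {n k : ℕ} (τ : Fin n → Fin k) (Q : Kernel (Fin k → X) (Config X))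
    [IsMarkovKernel Q] {g : Measure X → ℝ≥0∞} (hg : Measurable g) {β : Type*} [MeasurableSpace β]
    {z : β → Fin k → X} (hz : Measurable z) {u : β → ℝ} (hu : Measurable u) :
    Measurable fun b => palmMass H τ (rmLaw (Q (z b)) H) (z b) (u b) g := by
  have hzu : Measurable fun b => (z b, u b) := hz.prodMk hu
  have hmass := measurable_palmMass (H := H) τ (Q := Q) hg
  have hcomp := hmass.comp hzu
  exact hcomp

lemma mem_patternSet_and_eq_comp {X : Type*} {n k : ℕ} {y : Fin n → X} {ystar : Fin k → X}
    {τ : Fin n → Fin k} (hd : IsDistinctValues y ystar τ) :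
    y ∈ patternSet X τ ∧ ystar = y ∘ Function.surjInv hd.surjective := by
  refine ⟨⟨ystar, hd.injective, funext hd.eq_comp⟩, funext fun j => ?_⟩
  rw [Function.comp_apply, hd.eq_comp, Function.surjInv_eq hd.surjective]

variable {X : Type*} [MeasurableSpace X] {H : Measure ℝ} [IsProbabilityMeasure H]
  {P : Measure (Config X)}

/-- The real codes determine finite measures only, so conditional laws must be known to be
concentrated on them. -/
lemma ae_jointLaw_isFiniteMeasure (n : ℕ) :
    ∀ᵐ p ∂(jointLaw P H n), IsFiniteMeasure p.2 := by
  have hS : MeasurableSet {p : ((Fin n → X) × ℝ) × Measure X | IsFiniteMeasure p.2} :=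
    measurable_snd measurableSet_isFiniteMeasure
  have hF := (measurable_one (α := ℝ≥0∞)).indicator hS.compl
  change jointLaw P H n {p | IsFiniteMeasure p.2}ᶜ = 0
  rw [← lintegral_indicator_one hS.compl, jointLaw_eq_bind,
    Measure.lintegral_bind (obsKernel X n).aemeasurable hF.aemeasurable]
  refine (lintegral_congr_ae ((ae_rmLaw_isFiniteMeasure P).mono fun μ hμ => ?_)).trans
    lintegral_zero
  rw [lintegral_obsKernel μ hF]
  simp [hμ]

/-- The unnormalized posterior law of the auxiliary variable. -/
def auxMass (H : Measure ℝ) (n : ℕ) {k : ℕ} (τ : Fin n → Fin k)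
    (ρ : Measure (Measure X)) (z : Fin k → X) (L : Set ℝ) : ℝ≥0∞ :=
  ∫⁻ u in Set.Ioi 0, gammaWeight n u * (L.indicator 1 u * palmMass H τ ρ z u 1)

lemma measurable_auxMass (H : Measure ℝ) [IsProbabilityMeasure H] {n k : ℕ} (τ : Fin n → Fin k)
    (Q : Kernel (Fin k → X) (Config X)) [IsMarkovKernel Q] {L : Set ℝ} (hL : MeasurableSet L) :
    Measurable fun z => auxMass H n τ (rmLaw (Q z) H) z L := by
  have hind : Measurable (L.indicator (1 : ℝ → ℝ≥0∞)) := measurable_one.indicator hL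
  have hm : Measurable fun q : (Fin k → X) × ℝ => gammaWeight n q.2 *
      (L.indicator 1 q.2 * palmMass H τ (rmLaw (Q q.1) H) q.1 q.2 1) :=
    Measurable.mul (by fun_prop) ((hind.comp measurable_snd).mul
      (measurable_palmMass_comp H τ Q measurable_one measurable_fst measurable_snd))
  exact hm.lintegral_prod_right'

lemma gammaWeight_ne_zero {n : ℕ} (hn : 1 ≤ n) {u : ℝ} (hu : 0 < u) : gammaWeight n u ≠ 0 := by
  have hG : 0 < Real.Gamma n := Real.Gamma_pos_of_pos (by exact_mod_cast hn)
  exact mul_ne_zero (ENNReal.ofReal_pos.2 (by positivity)).ne'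
    (ENNReal.ofReal_pos.2 (by positivity)).ne'

/-- The density of the auxiliary variable given the observations, up to a constant. -/
def auxDensity (H : Measure ℝ) {n k : ℕ} (τ : Fin n → Fin k) (ρ : Measure (Measure X)) (u : ℝ) :
    ℝ≥0∞ :=
  ENNReal.ofReal (u ^ (n - 1)) * laplace ρ (fun _ => u.toNNReal) * ∏ j, kappa H u (count τ j)

lemma auxMass_eq {n k : ℕ} (hpos : ∀ᵐ s ∂H, 0 < s) (τ : Fin n → Fin k)
    (ρ : Measure (Measure X)) (z : Fin k → X) {L : Set ℝ} (hL : MeasurableSet L) :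
    auxMass H n τ ρ z L = ENNReal.ofReal (Real.Gamma n)⁻¹ *
      (volume.restrict (Set.Ioi 0)).withDensity (auxDensity H τ ρ) L := by
  rw [withDensity_apply _ hL, ← lintegral_indicator hL,
    ← lintegral_const_mul' _ _ ENNReal.ofReal_ne_top, auxMass]
  refine setLIntegral_congr_fun measurableSet_Ioi fun u hu => ?_
  rw [palmMass_one hpos τ ρ z hu, gammaWeight]
  by_cases hmem : u ∈ L
  · rw [Set.indicator_of_mem hmem, Set.indicator_of_mem hmem, auxDensity, Pi.one_apply]
    ring
  · rw [Set.indicator_of_notMem hmem, Set.indicator_of_notMem hmem]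
    simp

/-- The constant 1 / Γ(n) drops out of the ratio. The points `z` play no role, since the mass of the
constant function 1 does not depend on them. -/
lemma lawWithDensityPropTo_auxDensity_apply {n k : ℕ} (hn : 1 ≤ n) (hpos : ∀ᵐ s ∂H, 0 < s)
    (τ : Fin n → Fin k) (ρ : Measure (Measure X)) (z : Fin k → X) {L : Set ℝ}
    (hL : MeasurableSet L) : lawWithDensityPropTo (auxDensity H τ ρ) L =
      (auxMass H n τ ρ z Set.univ)⁻¹ * auxMass H n τ ρ z L := by
  have hG : 0 < Real.Gamma n := Real.Gamma_pos_of_pos (by exact_mod_cast hn)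
  have h0 : ENNReal.ofReal (Real.Gamma n)⁻¹ ≠ 0 := (ENNReal.ofReal_pos.2 (by positivity)).ne'
  rw [auxMass_eq hpos τ ρ z MeasurableSet.univ, auxMass_eq hpos τ ρ z hL,
    ENNReal.mul_inv (Or.inl h0) (Or.inl ENNReal.ofReal_ne_top), mul_mul_mul_comm,
    ENNReal.inv_mul_cancel h0 ENNReal.ofReal_ne_top, one_mul]
  rfl

/-- The integrand is strictly positive on the whole half-line, which has positive Lebesgue measure.
-/
lemma auxMass_univ_ne_zero {n k : ℕ} (hn : 1 ≤ n) (hpos : ∀ᵐ s ∂H, 0 < s) (τ : Fin n → Fin k)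
    {Q : Kernel (Fin k → X) (Config X)} [IsMarkovKernel Q] (z : Fin k → X) :
    auxMass H n τ (rmLaw (Q z) H) z Set.univ ≠ 0 := by
  intro h0
  have hm : Measurable fun u : ℝ => gammaWeight n u *
      (Set.univ.indicator 1 u * palmMass H τ (rmLaw (Q z) H) z u 1) :=
    Measurable.mul (by fun_prop) ((measurable_one.indicator MeasurableSet.univ).mul
      (measurable_palmMass_comp H τ Q measurable_one measurable_const measurable_id))
  rw [auxMass, lintegral_eq_zero_iff hm] at h0
  have h1 : ∀ᵐ u ∂(volume.restrict (Set.Ioi (0 : ℝ))), False := by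
    filter_upwards [h0, ae_restrict_mem measurableSet_Ioi] with u hu hu0
    refine mul_ne_zero (gammaWeight_ne_zero hn hu0) ?_ hu
    simpa using palmMass_one_ne_zero hpos τ (ae_rmLaw_isFiniteMeasure _) z hu0
  rw [Filter.eventually_false_iff_eq_bot, ae_eq_bot, Measure.restrict_eq_zero] at h1
  simp at h1

variable [StandardBorelSpace X]

lemma lintegral_fst_jointLaw {n k : ℕ} (hn : 1 ≤ n) (hpos : ∀ᵐ s ∂H, 0 < s)
    (hsimple : ∀ᵐ c ∂P, Function.Injective c.2) [SigmaFinite (momentMeasure P k)]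
    {Q : Kernel (Fin k → X) (Config X)} (hQ : IsReducedPalmKernel P k Q)
    {τ : Fin n → Fin k} (hτ : Function.Surjective τ) {f : (Fin n → X) × ℝ → ℝ≥0∞}
    (hf : Measurable f) (hsupp : ∀ y u, y ∉ patternSet X τ → f (y, u) = 0) :
    ∫⁻ yu, f yu ∂(jointLaw P H n).fst = ∫⁻ z in injSet X k, (∫⁻ u in Set.Ioi 0,
      gammaWeight n u * (f (z ∘ τ, u) * palmMass H τ (rmLaw (Q z) H) z u 1))
      ∂(momentMeasure P k) := by
  rw [← lintegral_jointLaw_mul hn hpos hsimple hQ hτ hf hsupp measurable_one, Measure.fst,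
    lintegral_map hf measurable_fst]
  simp

lemma ae_fst_jointLaw_pos {n k : ℕ} (hn : 1 ≤ n) (hpos : ∀ᵐ s ∂H, 0 < s)
    (hsimple : ∀ᵐ c ∂P, Function.Injective c.2) [SigmaFinite (momentMeasure P k)]
    {Q : Kernel (Fin k → X) (Config X)} (hQ : IsReducedPalmKernel P k Q)
    {τ : Fin n → Fin k} (hτ : Function.Surjective τ) :
    ∀ᵐ yu ∂(jointLaw P H n).fst, yu.1 ∈ patternSet X τ → 0 < yu.2 := by
  let S : Set ((Fin n → X) × ℝ) := patternSet X τ ×ˢ Set.Iic 0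
  have hS : MeasurableSet S := (measurableSet_patternSet hτ).prod measurableSet_Iic
  have h0 : (jointLaw P H n).fst S = 0 := by
    rw [← lintegral_indicator_one hS, lintegral_fst_jointLaw hn hpos hsimple hQ hτ
      (measurable_one.indicator hS) fun y u hy => Set.indicator_of_notMem (fun h => hy h.1) _]
    refine (lintegral_congr fun z => ?_).trans lintegral_zero
    refine (setLIntegral_congr_fun measurableSet_Ioi fun u hu => ?_).trans lintegral_zero
    rw [Set.indicator_of_notMem fun h => not_le.2 (Set.mem_Ioi.1 hu) (Set.mem_Iic.1 h.2)]
    simp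
  filter_upwards [measure_eq_zero_iff_ae_notMem.1 h0] with yu hyu hmem
  exact not_le.1 fun h => hyu ⟨hmem, h⟩

/-- Both sides are evaluated by the Palm formula. On the right, the observation marginal contributes
the factor `palmMass` of 1, which cancels the normalizer and leaves `palmMass` of the indicator of
`L`. -/
lemma jointLaw_prod_eq {n k : ℕ} (hn : 1 ≤ n) (hpos : ∀ᵐ s ∂H, 0 < s)
    (hsimple : ∀ᵐ c ∂P, Function.Injective c.2) [SigmaFinite (momentMeasure P k)]
    {Q : Kernel (Fin k → X) (Config X)} (hQ : IsReducedPalmKernel P k Q)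
    {τ : Fin n → Fin k} {σ : Fin k → Fin n} (hσ : ∀ j, τ (σ j) = j) {L : Set (Measure X)}
    (hL : MeasurableSet L) {E : Set ((Fin n → X) × ℝ)} (hE : MeasurableSet E)
    (hEτ : ∀ yu ∈ E, yu.1 ∈ patternSet X τ) :
    jointLaw P H n (E ×ˢ L) = ∫⁻ yu in E,
      (palmMass H τ (rmLaw (Q (yu.1 ∘ σ)) H) (yu.1 ∘ σ) yu.2 1)⁻¹ *
        palmMass H τ (rmLaw (Q (yu.1 ∘ σ)) H) (yu.1 ∘ σ) yu.2 (L.indicator 1)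
      ∂(jointLaw P H n).fst := by
  have := hQ.isMarkovKernel
  have hτ : Function.Surjective τ := fun j => ⟨σ j, hσ j⟩
  have hz : ∀ z : Fin k → X, (z ∘ τ) ∘ σ = z := fun z => funext fun j => congrArg z (hσ j)
  have hy : Measurable fun yu : (Fin n → X) × ℝ => yu.1 ∘ σ :=
    (measurable_comp_index σ).comp measurable_fst
  have hind : Measurable (L.indicator (1 : Measure X → ℝ≥0∞)) := measurable_one.indicator hL
  have hb : Measurable fun yu : (Fin n → X) × ℝ =>
      (palmMass H τ (rmLaw (Q (yu.1 ∘ σ)) H) (yu.1 ∘ σ) yu.2 1)⁻¹ *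
        palmMass H τ (rmLaw (Q (yu.1 ∘ σ)) H) (yu.1 ∘ σ) yu.2 (L.indicator 1) :=
    (measurable_palmMass_comp H τ Q measurable_one hy measurable_snd).inv.mul
      (measurable_palmMass_comp H τ Q hind hy measurable_snd)
  rw [← lintegral_indicator hE, lintegral_fst_jointLaw hn hpos hsimple hQ hτ (hb.indicator hE)
    fun y u hy => Set.indicator_of_notMem (fun h => hy (hEτ _ h)) _,
    ← lintegral_indicator_one (hE.prod hL)]
  have hprod : ∀ p : ((Fin n → X) × ℝ) × Measure X, (E ×ˢ L).indicator (1 : _ × _ → ℝ≥0∞) p =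
      E.indicator 1 p.1 * L.indicator 1 p.2 := fun p =>
    Set.indicator_prod_one (s := E) (t := L) (i := p.1) (j := p.2)
  rw [lintegral_congr hprod, lintegral_jointLaw_mul hn hpos hsimple hQ hτ
    (measurable_one.indicator hE)
    (fun y u hy => Set.indicator_of_notMem (fun h => hy (hEτ _ h)) _) hind]
  refine lintegral_congr fun z => setLIntegral_congr_fun measurableSet_Ioi fun u hu => ?_
  refine congrArg (gammaWeight n u * ·) ?_
  by_cases hmem : (z ∘ τ, u) ∈ E
  · rw [Set.indicator_of_mem hmem, Set.indicator_of_mem hmem]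
    simp only [hz, Pi.one_apply, one_mul]
    rw [mul_comm, ← mul_assoc, ENNReal.mul_inv_cancel
      (palmMass_one_ne_zero hpos τ (ae_rmLaw_isFiniteMeasure _) z hu)
      (palmMass_one_ne_top hpos τ _ z hu), one_mul]
  · rw [Set.indicator_of_notMem hmem, Set.indicator_of_notMem hmem, zero_mul, zero_mul]

/-- The conditional law of the random measure, on the event that the observations have the
pattern `τ`. -/
theorem ae_condKernel_eq_posteriorLaw [IsProbabilityMeasure P] {h : ℝ → ℝ≥0∞} (hh : Measurable h)
    (hH : H = (volume.restrict (Set.Ioi 0)).withDensity h) {n k : ℕ} (hn : 1 ≤ n)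
    (hpos : ∀ᵐ s ∂H, 0 < s) (hsimple : ∀ᵐ c ∂P, Function.Injective c.2)
    [SigmaFinite (momentMeasure P k)] {Q : Kernel (Fin k → X) (Config X)}
    (hQ : IsReducedPalmKernel P k Q) {τ : Fin n → Fin k} (hτ : Function.Surjective τ)
    {K : Kernel ((Fin n → X) × ℝ) (Measure X)} [IsMarkovKernel K]
    (hK : (jointLaw P H n).IsCondKernel K) :
    ∀ᵐ yu ∂(jointLaw P H n).fst, ∀ ystar : Fin k → X, IsDistinctValues yu.1 ystar τ →
      0 < yu.2 ∧ K yu = posteriorLaw h τ (rmLaw (Q ystar) H) ystar yu.2 := by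
  have := hQ.isMarkovKernel
  have hσ := Function.surjInv_eq hτ
  have hL : ∀ q : ℚ, MeasurableSet (code X ⁻¹' Set.Iio (q : ℝ)) := fun q =>
    measurable_code measurableSet_Iio
  have hy : Measurable fun yu : (Fin n → X) × ℝ => yu.1 ∘ Function.surjInv hτ :=
    (measurable_comp_index _).comp measurable_fst
  -- For each rational half-line of codes, the conditional probability equals the normalized weight
  -- almost everywhere; countability then gives a common null set.
  have hprob := fun q : ℚ => ae_condKernel_eq hK
    (measurable_fst (measurableSet_patternSet (X := X) hτ)) (hL q)
    ((measurable_palmMass_comp H τ Q measurable_one hy measurable_snd).inv.mul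
      (measurable_palmMass_comp H τ Q (measurable_one.indicator (hL q)) hy measurable_snd))
    fun E hE hEτ => jointLaw_prod_eq hn hpos hsimple hQ hσ (hL q) hE hEτ
  have hfin : ∀ᵐ yu ∂(jointLaw P H n).fst, ∀ᵐ μ ∂(K yu), IsFiniteMeasure μ := by
    have h1 := ae_jointLaw_isFiniteMeasure (P := P) (H := H) n
    rw [← hK.disintegrate] at h1
    exact Measure.ae_ae_of_ae_compProd h1
  filter_upwards [ae_all_iff.2 hprob, hfin, ae_fst_jointLaw_pos hn hpos hsimple hQ hτ]
    with yu h1 h2 h3 ystar hd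
  obtain ⟨hmem, hy⟩ := mem_patternSet_and_eq_comp hd
  have hu := h3 hmem
  have hf := ae_rmLaw_isFiniteMeasure (H := H) (Q ystar)
  have := isProbabilityMeasure_posteriorLaw hh hH hpos τ hf ystar hu
  refine ⟨hu, ext_of_code h2 (ae_posteriorLaw_isFiniteMeasure hh hH hpos τ hf ystar hu)
    fun q => ?_⟩
  rw [h1 q hmem, posteriorLaw_apply hh hH hpos τ hf ystar hu (hL q), hy]
  rfl

section Auxiliary

lemma lintegral_fst_jointLaw_mul {n k : ℕ} (hn : 1 ≤ n) (hpos : ∀ᵐ s ∂H, 0 < s)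
    (hsimple : ∀ᵐ c ∂P, Function.Injective c.2) [SigmaFinite (momentMeasure P k)]
    {Q : Kernel (Fin k → X) (Config X)} (hQ : IsReducedPalmKernel P k Q)
    {τ : Fin n → Fin k} (hτ : Function.Surjective τ) {f : (Fin n → X) → ℝ≥0∞}
    (hf : Measurable f) (hsupp : ∀ y, y ∉ patternSet X τ → f y = 0)
    {L : Set ℝ} (hL : MeasurableSet L) :
    ∫⁻ yu, f yu.1 * L.indicator 1 yu.2 ∂(jointLaw P H n).fst = ∫⁻ z in injSet X k,
      f (z ∘ τ) * auxMass H n τ (rmLaw (Q z) H) z L ∂(momentMeasure P k) := by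
  have := hQ.isMarkovKernel
  have hind : Measurable (L.indicator (1 : ℝ → ℝ≥0∞)) := measurable_one.indicator hL
  rw [lintegral_fst_jointLaw hn hpos hsimple hQ hτ (f := fun yu => f yu.1 * L.indicator 1 yu.2)
    ((hf.comp measurable_fst).mul (hind.comp measurable_snd))
    fun y u hy => by rw [hsupp y hy, zero_mul]]
  refine lintegral_congr fun z => ?_
  have hm : Measurable fun u : ℝ => gammaWeight n u *
      (L.indicator 1 u * palmMass H τ (rmLaw (Q z) H) z u 1) :=
    Measurable.mul (by fun_prop) (hind.mul
      (measurable_palmMass_comp H τ Q measurable_one measurable_const measurable_id))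
  rw [auxMass, ← lintegral_const_mul _ hm]
  refine lintegral_congr fun u => ?_
  ring

lemma lintegral_fst_fst_jointLaw {n k : ℕ} (hn : 1 ≤ n) (hpos : ∀ᵐ s ∂H, 0 < s)
    (hsimple : ∀ᵐ c ∂P, Function.Injective c.2) [SigmaFinite (momentMeasure P k)]
    {Q : Kernel (Fin k → X) (Config X)} (hQ : IsReducedPalmKernel P k Q)
    {τ : Fin n → Fin k} (hτ : Function.Surjective τ) {f : (Fin n → X) → ℝ≥0∞}
    (hf : Measurable f) (hsupp : ∀ y, y ∉ patternSet X τ → f y = 0) :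
    ∫⁻ y, f y ∂(jointLaw P H n).fst.fst = ∫⁻ z in injSet X k,
      f (z ∘ τ) * auxMass H n τ (rmLaw (Q z) H) z Set.univ ∂(momentMeasure P k) := by
  rw [← lintegral_fst_jointLaw_mul hn hpos hsimple hQ hτ hf hsupp MeasurableSet.univ,
    Measure.fst, lintegral_map hf measurable_fst]
  simp

variable [IsProbabilityMeasure P]

/-- Integrated over distinct tuples, this mass is the probability of the pattern τ, which is finite.
No pointwise estimate in `u` is needed. -/
lemma ae_auxMass_lt_top {n k : ℕ} (hn : 1 ≤ n) (hpos : ∀ᵐ s ∂H, 0 < s)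
    (hsimple : ∀ᵐ c ∂P, Function.Injective c.2) [SigmaFinite (momentMeasure P k)]
    {Q : Kernel (Fin k → X) (Config X)} (hQ : IsReducedPalmKernel P k Q)
    {τ : Fin n → Fin k} (hτ : Function.Surjective τ) :
    ∀ᵐ z ∂((momentMeasure P k).restrict (injSet X k)),
      auxMass H n τ (rmLaw (Q z) H) z Set.univ < ∞ := by
  have := hQ.isMarkovKernel
  have hD := measurableSet_patternSet (X := X) hτ
  have h := lintegral_fst_fst_jointLaw (H := H) hn hpos hsimple hQ hτ
    (measurable_one.indicator hD) fun y hy => Set.indicator_of_notMem hy _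
  rw [lintegral_indicator_one hD] at h
  refine ae_lt_top (measurable_auxMass H τ Q MeasurableSet.univ) ?_
  rw [setLIntegral_congr_fun (measurableSet_injSet k) (g := fun z =>
    (patternSet X τ).indicator 1 (z ∘ τ) * auxMass H n τ (rmLaw (Q z) H) z Set.univ)
    fun z hz => ?_, ← h]
  · exact measure_ne_top _ _
  · have hz' : z ∘ τ ∈ patternSet X τ := ⟨z, hz, rfl⟩
    beta_reduce
    rw [Set.indicator_of_mem hz', Pi.one_apply, one_mul]

/-- The normalizer cancels as in `jointLaw_prod_eq`, now with the auxiliary variable integrated out.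
Its finiteness holds only almost everywhere for the moment measure. -/
lemma fst_jointLaw_prod_eq {n k : ℕ} (hn : 1 ≤ n) (hpos : ∀ᵐ s ∂H, 0 < s)
    (hsimple : ∀ᵐ c ∂P, Function.Injective c.2) [SigmaFinite (momentMeasure P k)]
    {Q : Kernel (Fin k → X) (Config X)} (hQ : IsReducedPalmKernel P k Q)
    {τ : Fin n → Fin k} {σ : Fin k → Fin n} (hσ : ∀ j, τ (σ j) = j) {L : Set ℝ}
    (hL : MeasurableSet L) {E : Set (Fin n → X)} (hE : MeasurableSet E)
    (hEτ : E ⊆ patternSet X τ) :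
    (jointLaw P H n).fst (E ×ˢ L) = ∫⁻ y in E,
      (auxMass H n τ (rmLaw (Q (y ∘ σ)) H) (y ∘ σ) Set.univ)⁻¹ *
        auxMass H n τ (rmLaw (Q (y ∘ σ)) H) (y ∘ σ) L ∂(jointLaw P H n).fst.fst := by
  have := hQ.isMarkovKernel
  have hτ : Function.Surjective τ := fun j => ⟨σ j, hσ j⟩
  have hz : ∀ z : Fin k → X, (z ∘ τ) ∘ σ = z := fun z => funext fun j => congrArg z (hσ j)
  have hb : Measurable fun y : Fin n → X =>
      (auxMass H n τ (rmLaw (Q (y ∘ σ)) H) (y ∘ σ) Set.univ)⁻¹ *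
        auxMass H n τ (rmLaw (Q (y ∘ σ)) H) (y ∘ σ) L :=
    ((measurable_auxMass H τ Q MeasurableSet.univ).comp (measurable_comp_index σ)).inv.mul
      ((measurable_auxMass H τ Q hL).comp (measurable_comp_index σ))
  rw [← lintegral_indicator hE, lintegral_fst_fst_jointLaw hn hpos hsimple hQ hτ
    (hb.indicator hE) fun y hy => Set.indicator_of_notMem (fun h => hy (hEτ h)) _,
    ← lintegral_indicator_one (hE.prod hL)]
  have hprod : ∀ p : (Fin n → X) × ℝ, (E ×ˢ L).indicator (1 : _ × _ → ℝ≥0∞) p =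
      E.indicator 1 p.1 * L.indicator 1 p.2 := fun p =>
    Set.indicator_prod_one (s := E) (t := L) (i := p.1) (j := p.2)
  rw [lintegral_congr hprod, lintegral_fst_jointLaw_mul hn hpos hsimple hQ hτ
    (measurable_one.indicator hE) (fun y hy => Set.indicator_of_notMem (fun h => hy (hEτ h)) _) hL]
  refine lintegral_congr_ae ?_
  filter_upwards [ae_auxMass_lt_top hn hpos hsimple hQ hτ] with z hlt
  by_cases hmem : z ∘ τ ∈ E
  · rw [Set.indicator_of_mem hmem, Set.indicator_of_mem hmem]
    simp only [hz, Pi.one_apply, one_mul]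
    rw [mul_comm, ← mul_assoc, ENNReal.mul_inv_cancel (auxMass_univ_ne_zero hn hpos τ z) hlt.ne,
      one_mul]
  · rw [Set.indicator_of_notMem hmem, Set.indicator_of_notMem hmem, zero_mul, zero_mul]

/-- The conditional law of the auxiliary variable, on the event that the observations have the
pattern `τ`. -/
theorem ae_condKernel_eq_lawWithDensityPropTo {n k : ℕ} (hn : 1 ≤ n) (hpos : ∀ᵐ s ∂H, 0 < s)
    (hsimple : ∀ᵐ c ∂P, Function.Injective c.2) [SigmaFinite (momentMeasure P k)]
    {Q : Kernel (Fin k → X) (Config X)} (hQ : IsReducedPalmKernel P k Q)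
    {τ : Fin n → Fin k} (hτ : Function.Surjective τ) {K : Kernel (Fin n → X) ℝ} [IsMarkovKernel K]
    (hK : (jointLaw P H n).fst.IsCondKernel K) :
    ∀ᵐ y ∂(jointLaw P H n).fst.fst, ∀ ystar : Fin k → X, IsDistinctValues y ystar τ →
      K y = lawWithDensityPropTo (auxDensity H τ (rmLaw (Q ystar) H)) := by
  have := hQ.isMarkovKernel
  have hσ := Function.surjInv_eq hτ
  have hD := measurableSet_patternSet (X := X) hτ
  have hmass := fun (L : Set ℝ) (hL : MeasurableSet L) =>
    (measurable_auxMass H (n := n) τ Q hL).comp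
      (measurable_comp_index (Function.surjInv hτ))
  have hprob := fun q : ℚ => ae_condKernel_eq hK hD (measurableSet_Iio (a := (q : ℝ)))
    ((hmass _ MeasurableSet.univ).inv.mul (hmass _ measurableSet_Iio))
    fun E hE hEτ => fst_jointLaw_prod_eq hn hpos hsimple hQ hσ measurableSet_Iio hE hEτ
  -- Taking the whole line as the event equates `K y Set.univ = 1` with the total mass of the
  -- candidate law. This shows that the latter is a probability measure.
  have huniv := ae_condKernel_eq hK hD MeasurableSet.univ
    ((hmass _ MeasurableSet.univ).inv.mul (hmass _ MeasurableSet.univ))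
    fun E hE hEτ => fst_jointLaw_prod_eq hn hpos hsimple hQ hσ MeasurableSet.univ hE hEτ
  filter_upwards [ae_all_iff.2 hprob, huniv] with y h1 h2 ystar hd
  obtain ⟨hmem, hy⟩ := mem_patternSet_and_eq_comp hd
  have hlaw := fun (L : Set ℝ) (hL : MeasurableSet L) =>
    lawWithDensityPropTo_auxDensity_apply hn hpos τ (rmLaw (Q ystar) H) ystar hL
  have : IsProbabilityMeasure (lawWithDensityPropTo (auxDensity H τ (rmLaw (Q ystar) H))) := by
    refine ⟨?_⟩
    rw [hlaw _ MeasurableSet.univ, ← measure_univ (μ := K y), h2 hmem, hy]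
    rfl
  refine ext_real_of_Iio_rat fun q => ?_
  rw [h1 q hmem, hlaw _ measurableSet_Iio, hy]
  rfl

end Auxiliary

end ConditionalLaws

end NRM

end

/-! ### Assembly over all patterns of ties -/

theorem mainTheorem1 {X : Type*} [TopologicalSpace X] [PolishSpace X] [MeasurableSpace X]
    [BorelSpace X]
    -- the law of the points of a finite simple point process
    (P : Measure (NRM.Config X)) [IsProbabilityMeasure P]
    (hsimple : ∀ᵐ c ∂P, Function.Injective c.2)
    -- the law of the marks, with density `h` on the positive half-line
    (H : Measure ℝ) [IsProbabilityMeasure H] (h : ℝ → ℝ≥0∞) (hh : Measurable h)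
    (hH : H = (volume.restrict (Set.Ioi 0)).withDensity h)
    (n : ℕ) (hn : 1 ≤ n)
    (hM : ∀ k, 1 ≤ k → k ≤ n → SigmaFinite (NRM.momentMeasure P k)) :
    -- the reduced Palm kernels and the regular conditional distributions exist, and
    (∀ k, 1 ≤ k → k ≤ n →
      ∃ Q : Kernel (Fin k → X) (NRM.Config X), NRM.IsReducedPalmKernel P k Q) ∧
    (∃ K : Kernel ((Fin n → X) × ℝ) (Measure X),
      IsMarkovKernel K ∧ (NRM.jointLaw P H n).IsCondKernel K) ∧
    (∃ KU : Kernel (Fin n → X) ℝ,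
      IsMarkovKernel KU ∧ (NRM.jointLaw P H n).fst.IsCondKernel KU) ∧
    -- for all versions of the reduced Palm kernels:
    ∀ Q : (k : ℕ) → Kernel (Fin k → X) (NRM.Config X),
      (∀ k, 1 ≤ k → k ≤ n → NRM.IsReducedPalmKernel P k (Q k)) →
      -- the conditional law of the random measure given `Y = y` and `U_n = u`
      (∀ K : Kernel ((Fin n → X) × ℝ) (Measure X), IsMarkovKernel K →
        (NRM.jointLaw P H n).IsCondKernel K →
        ∀ᵐ yu ∂(NRM.jointLaw P H n).fst,
          ∀ (k : ℕ) (ystar : Fin k → X) (τ : Fin n → Fin k),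
            NRM.IsDistinctValues yu.1 ystar τ →
            ∃ ρ : Measure (Measure X), IsProbabilityMeasure ρ ∧
              (∀ f : X → ℝ≥0, Measurable f →
                NRM.laplace ρ f =
                  NRM.laplace (NRM.rmLaw (Q k ystar) H) (fun z => f z + yu.2.toNNReal) /
                    NRM.laplace (NRM.rmLaw (Q k ystar) H) (fun _ => yu.2.toNNReal)) ∧
              K yu =
                ((Measure.pi fun j : Fin k => NRM.lawWithDensityPropTo fun s =>
                    ENNReal.ofReal (Real.exp (-yu.2 * s) * s ^ NRM.count τ j) * h s).prod ρ).map
                  fun sμ => NRM.atomic ystar sμ.1 + sμ.2) ∧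
      -- the conditional law of `U_n` given `Y = y`
      (∀ KU : Kernel (Fin n → X) ℝ, IsMarkovKernel KU →
        (NRM.jointLaw P H n).fst.IsCondKernel KU →
        ∀ᵐ y ∂(NRM.jointLaw P H n).fst.fst,
          ∀ (k : ℕ) (ystar : Fin k → X) (τ : Fin n → Fin k),
            NRM.IsDistinctValues y ystar τ →
            KU y = NRM.lawWithDensityPropTo fun u =>
              ENNReal.ofReal (u ^ (n - 1)) *
                NRM.laplace (NRM.rmLaw (Q k ystar) H) (fun _ => u.toNNReal) *
                ∏ j, NRM.kappa H u (NRM.count τ j)) := by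
  have hpos : ∀ᵐ s ∂H, 0 < s := by
    rw [hH]
    exact (withDensity_absolutelyContinuous _ _).ae_le (ae_restrict_mem measurableSet_Ioi)
  have hk {k : ℕ} {τ : Fin n → Fin k} (hτ : Function.Surjective τ) : 1 ≤ k ∧ k ≤ n :=
    ⟨(Nat.zero_le _).trans_lt (τ ⟨0, hn⟩).isLt,
      by simpa using Fintype.card_le_of_surjective τ hτ⟩
  refine ⟨fun k hk1 hkn => ?_, NRM.exists_jointLaw_isCondKernel P n,
    ⟨(NRM.jointLaw P H n).fst.condKernel, inferInstance, inferInstance⟩,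
    fun Q hQ => ⟨fun K hKm hK => ?_, fun KU hKm hKU => ?_⟩⟩
  · have := hM k hk1 hkn
    obtain ⟨Q, _, hQ⟩ := NRM.exists_kernel_lintegral_reducedCampbell hsimple k
    exact ⟨Q, NRM.isReducedPalmKernel_of_lintegral hsimple hQ⟩
  -- There are countably many pairs of `k` and τ, so the exceptional sets combine; a τ that is not
  -- surjective labels no distinct values. Reorderings of the distinct values are covered by the
  -- other choices of τ.
  · have hae : ∀ᵐ yu ∂(NRM.jointLaw P H n).fst, ∀ (k : ℕ) (τ : Fin n → Fin k)
        (ystar : Fin k → X), NRM.IsDistinctValues yu.1 ystar τ →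
        K yu = NRM.posteriorLaw h τ (NRM.rmLaw (Q k ystar) H) ystar yu.2 := by
      refine ae_all_iff.2 fun k => ae_all_iff.2 fun τ => ?_
      by_cases hτ : Function.Surjective τ
      · obtain ⟨hk1, hkn⟩ := hk hτ
        have := hM k hk1 hkn
        filter_upwards [NRM.ae_condKernel_eq_posteriorLaw hh hH hn hpos hsimple (hQ k hk1 hkn)
          hτ hK] with yu hyu ystar hd
        exact (hyu ystar hd).2
      · exact Filter.Eventually.of_forall fun yu ystar hd => absurd hd.surjective hτ
    filter_upwards [hae] with yu hyu k ystar τ hd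
    obtain ⟨hk1, hkn⟩ := hk hd.surjective
    have := (hQ k hk1 hkn).isMarkovKernel
    -- The remainder is the reduced Palm random measure tilted by its total mass, and `posteriorLaw`
    -- was built with exactly this factor.
    exact ⟨NRM.tilt (NRM.rmLaw (Q k ystar) H) yu.2,
      NRM.isProbabilityMeasure_tilt (NRM.ae_rmLaw_isFiniteMeasure _) _,
      fun f hf => NRM.laplace_tilt _ hf, hyu k τ ystar hd⟩
  · have hae : ∀ᵐ y ∂(NRM.jointLaw P H n).fst.fst, ∀ (k : ℕ) (τ : Fin n → Fin k)
        (ystar : Fin k → X), NRM.IsDistinctValues y ystar τ →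
        KU y = NRM.lawWithDensityPropTo
          (NRM.auxDensity H τ (NRM.rmLaw (Q k ystar) H)) := by
      refine ae_all_iff.2 fun k => ae_all_iff.2 fun τ => ?_
      by_cases hτ : Function.Surjective τ
      · obtain ⟨hk1, hkn⟩ := hk hτ
        have := hM k hk1 hkn
        exact NRM.ae_condKernel_eq_lawWithDensityPropTo hn hpos hsimple (hQ k hk1 hkn) hτ hKU
      · exact Filter.Eventually.of_forall fun y ystar hd => absurd hd.surjective hτ
    filter_upwards [hae] with y hy k ystar τ hd
    exact hy k τ ystar hd
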